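/- Let $d\ge 1$ and let $\Omega:\mathbb R^d\setminus\{0\}\to\mathbb R$ be homogeneous of degree $0$, of class $C^1$ on the unit sphere $\mathbb S^{d-1}$, not identically zero, and with $\int_{\mathbb S^{d-1}}\Omega\,d\sigma=0$. Let $T$ be the classical Calderón–Zygmund operator $$Tf(x)=\mathrm{p.v.}\int_{\mathbb R^d}\frac{\Omega(x-y)}{|x-y|^d}f(y)\,dy=\lim_{\varepsilon\to0^+}\int_{|x-y|>\varepsilon}\frac{\Omega(x-y)}{|x-y|^d}f(y)\,dy .$$ For a weight $w$, i.e. a measurable function $w:\mathbb R^d\to[0,\infty]$, write $w(E)=\int_E w(x)\,dx$, let $Mw(x)=\sup_{Q\ni x}\frac1{|Q|}\int_Q w$ be the non-centered Hardy–Littlewood maximal function over cubes $Q$ with sides parallel to the coordinate axes, and let $L^1(Mw)$ be the space of measurable functions $f$ vanishing almost everywhere on $\{Mw=0\}$ with $\int|f|\,Mw<\infty$. Then for every $N>0$ there are a weight $w$, a real-valued function $f\in L^1(Mw)$ with $\int|f|\,Mw>0$ for which the principal value $Tf(x)$ exists for almost every $x$, and a number $\lambda>0$, such that $$w(\{x\in\mathbb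 R^d:|Tf(x)|>\lambda\})\ \ge\ \frac N\lambda\int_{\mathbb R^d}|f(x)|\,Mw(x)\,dx .$$ Consequently, for no such $T$, in any dimension $d\ge1$, is there a constant $C>0$ such that $w(\{|Tf|>\lambda\})\le\frac C\lambda\int|f|\,Mw$ for all weights $w$, all $\lambda>0$ and all $f\in L^1(Mw)$ whose principal values exist almost everywhere; that is, the Muckenhoupt–Wheeden weak-type conjecture fails for every nonzero classical Calderón–Zygmund operator. -/

import Mathlib

open MeasureTheory Filter Topology
open scoped ENNReal

noncomputable section

namespace MuckenhouptWheeden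

/-- A real function `Ω` that is homogeneous of degree `0`, of class `C¹` on the unit sphere
(for a function homogeneous of degree `0` this is the same as being `C¹` off the origin), and of
mean zero on the unit sphere with respect to surface measure. The value `Ω 0` plays no role. -/
structure IsCZSymbol {d : ℕ} (Ω : EuclideanSpace ℝ (Fin d) → ℝ) : Prop where
  homogeneous : ∀ r : ℝ, 0 < r → ∀ x : EuclideanSpace ℝ (Fin d), x ≠ 0 → Ω (r • x) = Ω x
  contDiffOn : ContDiffOn ℝ 1 Ω {0}ᶜ
  mean_zero : ∫ z : Metric.sphere (0 : EuclideanSpace ℝ (Fin d)) 1, Ω z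
      ∂(volume : Measure (EuclideanSpace ℝ (Fin d))).toSphere = 0

/-- The kernel `K(x, y) = Ω(x - y) / |x - y|^d`. -/
def czKernel {d : ℕ} (Ω : EuclideanSpace ℝ (Fin d) → ℝ) (x y : EuclideanSpace ℝ (Fin d)) : ℝ :=
  Ω (x - y) / ‖x - y‖ ^ d

/-- The truncated integral `∫_{|x - y| > ε} K(x, y) f(y) dy`. -/
def czTruncated {d : ℕ} (Ω f : EuclideanSpace ℝ (Fin d) → ℝ) (ε : ℝ)
    (x : EuclideanSpace ℝ (Fin d)) : ℝ :=
  ∫ y in {y | ε < ‖x - y‖}, czKernel Ω x y * f y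

/-- The principal value `p.v. ∫ K(x, y) f(y) dy` exists at `x` and is equal to `l`: all truncated
integrals converge absolutely, and they tend to `l` as `ε → 0⁺`. -/
def HasPrincipalValue {d : ℕ} (Ω f : EuclideanSpace ℝ (Fin d) → ℝ)
    (x : EuclideanSpace ℝ (Fin d)) (l : ℝ) : Prop :=
  (∀ ε : ℝ, 0 < ε → IntegrableOn (fun y => czKernel Ω x y * f y) {y | ε < ‖x - y‖}) ∧
    Tendsto (fun ε => czTruncated Ω f ε x) (𝓝[>] 0) (𝓝 l)

/-- The singular integral `T f (x) = p.v. ∫ K(x, y) f(y) dy`; it is meaningful at the points `x`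
where the principal value exists. -/
def czOperator {d : ℕ} (Ω f : EuclideanSpace ℝ (Fin d) → ℝ)
    (x : EuclideanSpace ℝ (Fin d)) : ℝ :=
  limUnder (𝓝[>] (0 : ℝ)) (fun ε => czTruncated Ω f ε x)

/-- The closed cube with sides of length `r` parallel to the axes and lower corner `a`. -/
def cube {d : ℕ} (a : EuclideanSpace ℝ (Fin d)) (r : ℝ) : Set (EuclideanSpace ℝ (Fin d)) :=
  {y | ∀ i, a i ≤ y i ∧ y i ≤ a i + r}

/-- The non-centered Hardy-Littlewood maximal function over cubes, of a function with values
in `[0, ∞]`. -/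
def maximalFunction {d : ℕ} (w : EuclideanSpace ℝ (Fin d) → ℝ≥0∞)
    (x : EuclideanSpace ℝ (Fin d)) : ℝ≥0∞ :=
  ⨆ (a : EuclideanSpace ℝ (Fin d)) (r : ℝ) (_ : 0 < r) (_ : x ∈ cube a r),
    (∫⁻ y in cube a r, w y) / volume (cube a r)

/-- The weighted norm `∫ |f| u`. -/
def weightedNorm {d : ℕ} (f : EuclideanSpace ℝ (Fin d) → ℝ)
    (u : EuclideanSpace ℝ (Fin d) → ℝ≥0∞) : ℝ≥0∞ :=
  ∫⁻ x, ‖f x‖ₑ * u x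

/-- `f ∈ L¹(u)`: `f` is measurable, vanishes (almost everywhere) where `u` does, and has finite
weighted norm. -/
def MemWeightedL1 {d : ℕ} (f : EuclideanSpace ℝ (Fin d) → ℝ)
    (u : EuclideanSpace ℝ (Fin d) → ℝ≥0∞) : Prop :=
  AEStronglyMeasurable f volume ∧ (∀ᵐ x, u x = 0 → f x = 0) ∧ weightedNorm f u < ∞

/-- `w(E) = ∫_E w`. -/
def weightOf {d : ℕ} (w : EuclideanSpace ℝ (Fin d) → ℝ≥0∞)
    (E : Set (EuclideanSpace ℝ (Fin d))) : ℝ≥0∞ :=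
  ∫⁻ x in E, w x

/-- The conjectured weak-type estimate for the operator with kernel `Ω(x - y) / |x - y|^d`: there
is `C > 0` such that `w({|T f| > t}) ≤ (C / t) ∫ |f| M w` for all weights `w`, all `t > 0` and
all `f ∈ L¹(M w)` (whose principal values exist almost everywhere). -/
def WeakTypeConjecture {d : ℕ} (Ω : EuclideanSpace ℝ (Fin d) → ℝ) : Prop :=
  ∃ C : ℝ, 0 < C ∧ ∀ w : EuclideanSpace ℝ (Fin d) → ℝ≥0∞, Measurable w →
    ∀ t : ℝ, 0 < t → ∀ f : EuclideanSpace ℝ (Fin d) → ℝ, MemWeightedL1 f (maximalFunction w) →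
      (∀ᵐ x, ∃ l, HasPrincipalValue Ω f x l) →
      weightOf w {x | t < |czOperator Ω f x|} ≤
        ENNReal.ofReal (C / t) * weightedNorm f (maximalFunction w)

end MuckenhouptWheeden

end

/-! The counterexample is a self-similar construction in the cell `‖x‖ ≤ 2`. After a possible change
of sign, `Ω ≥ c > 0` near some unit vector `e`. A cell contains a tiny core, the ball of radius `δ *
scale m` about the origin, and `m` child cells of relative size `δ * scale j` at the points `scale j
• e`, with `scale j = 4⁻ʲ`. To pass to the next generation, `f` is copied into every child and
receives the indicator of the core (`nextFunction`). The weight, of mass one, is copied into the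
children only, with a common density factor (`nextWeight`), so that child `j` has mass proportional
to `scale j ^ d`.

Write `h = (δ * scale m) ^ d`, the volume of the core up to a constant. In child `i` the core raises
`T f` by at least a multiple of `h / scale i ^ d`, which is inverse to the mass of that child. All
`m` children thus contribute equally, and the mean gain has order `m * h`. Siblings may lower `T f`,
but the mean loss is `O(h)` uniformly in `m`. The bound for `∫ |f| M w` also grows only by `O(h)`
uniformly in `m`: in the copies the loss of volume is balanced by the growth of density, and on the
core `M w` is bounded, since a cube reaching from the core to a child is at least as large as the
scale of that child.

After about `1 / h` generations the cost `∫ |f| M w` is bounded independently of `m`, while `T f`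
exceeds a multiple of `m` on most of the mass of `w`. This concentration is a Chernoff bound: the
bound for `∫ exp (-T f) w` is multiplied by `momentFactor` at each generation, which is at most `1 -
h * netGain / 2`, and Chebyshev's inequality finishes the argument. The main steps are
`maximalFunction_nextWeight_child_le`, `exists_hasPrincipalValue_nextFunction`, `momentFactor_le`
and `exists_parameters`. -/

namespace MuckenhouptWheeden

noncomputable section

/-! ### Affine changes of variable -/

section Dilation

variable {d : ℕ} {α : Type*}

/-- The function `g` transported to the ball of centre `c` and radius `ρ`. -/
def transport (c : EuclideanSpace ℝ (Fin d)) (ρ : ℝ) (g : EuclideanSpace ℝ (Fin d) → α) :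
    EuclideanSpace ℝ (Fin d) → α :=
  fun x => g (ρ⁻¹ • (x - c))

lemma transport_apply_affine {ρ : ℝ} (hρ : 0 < ρ) (c y : EuclideanSpace ℝ (Fin d))
    (g : EuclideanSpace ℝ (Fin d) → α) : transport c ρ g (c + ρ • y) = g y := by
  simp [transport, smul_smul, inv_mul_cancel₀ hρ.ne']

lemma affine_inverse {ρ : ℝ} (hρ : 0 < ρ) (c x : EuclideanSpace ℝ (Fin d)) :
    c + ρ • (ρ⁻¹ • (x - c)) = x := by
  simp [smul_smul, mul_inv_cancel₀ hρ.ne']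

lemma measurable_transport [MeasurableSpace α] (c : EuclideanSpace ℝ (Fin d)) (ρ : ℝ)
    {g : EuclideanSpace ℝ (Fin d) → α} (hg : Measurable g) : Measurable (transport c ρ g) :=
  hg.comp (by fun_prop)

lemma map_affine_inverse {ρ : ℝ} (hρ : 0 < ρ) (c : EuclideanSpace ℝ (Fin d)) :
    Measure.map (fun x => ρ⁻¹ • (x - c)) (volume : Measure (EuclideanSpace ℝ (Fin d))) =
      ENNReal.ofReal (ρ ^ d) • volume := by
  have h1 : (fun x : EuclideanSpace ℝ (Fin d) => ρ⁻¹ • (x - c)) =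
      (fun x => ρ⁻¹ • x) ∘ (fun x => x - c) := rfl
  rw [h1, ← Measure.map_map (by fun_prop) (by fun_prop),
    map_sub_right_eq_self, Measure.map_addHaar_smul _ (inv_ne_zero hρ.ne')]
  simp [abs_of_pos hρ]

/-- The map `x ↦ ρ⁻¹ • (x - c)` as a measurable embedding. -/
lemma measurableEmbedding_affine_inverse {ρ : ℝ} (hρ : 0 < ρ) (c : EuclideanSpace ℝ (Fin d)) :
    MeasurableEmbedding (fun x => ρ⁻¹ • (x - c)) :=
  (MeasurableEquiv.smul₀ ρ⁻¹ (inv_ne_zero hρ.ne')).measurableEmbedding.comp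
    (MeasurableEquiv.subRight c).measurableEmbedding

lemma lintegral_transport {ρ : ℝ} (hρ : 0 < ρ) (c : EuclideanSpace ℝ (Fin d))
    (g : EuclideanSpace ℝ (Fin d) → ℝ≥0∞) :
    ∫⁻ x, transport c ρ g x = ENNReal.ofReal (ρ ^ d) * ∫⁻ x, g x := by
  have := (measurableEmbedding_affine_inverse hρ c).lintegral_map (μ := volume) g
  rw [map_affine_inverse hρ c, lintegral_smul_measure] at this
  exact this.symm

lemma integral_transport {ρ : ℝ} (hρ : 0 < ρ) (c : EuclideanSpace ℝ (Fin d))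
    (g : EuclideanSpace ℝ (Fin d) → ℝ) :
    ∫ x, transport c ρ g x = ρ ^ d * ∫ x, g x := by
  have := (measurableEmbedding_affine_inverse hρ c).integral_map (μ := volume) g
  rw [map_affine_inverse hρ c, integral_smul_measure,
    ENNReal.toReal_ofReal (pow_nonneg hρ.le d)] at this
  exact this.symm

lemma integrable_transport {ρ : ℝ} (hρ : 0 < ρ) (c : EuclideanSpace ℝ (Fin d))
    {g : EuclideanSpace ℝ (Fin d) → ℝ} (hg : Integrable g) : Integrable (transport c ρ g) := by
  have := (measurableEmbedding_affine_inverse hρ c).integrable_map_iff (μ := volume) (g := g)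
  rw [map_affine_inverse hρ c] at this
  exact this.1 (hg.smul_measure ENNReal.ofReal_ne_top)

lemma ae_transport {ρ : ℝ} (hρ : 0 < ρ) (c : EuclideanSpace ℝ (Fin d))
    {p : EuclideanSpace ℝ (Fin d) → Prop} (hp : ∀ᵐ x, p x) : ∀ᵐ x, p (ρ⁻¹ • (x - c)) := by
  refine ae_of_ae_map (μ := volume) (measurableEmbedding_affine_inverse hρ c).measurable.aemeasurable ?_
  rw [map_affine_inverse hρ c]
  exact Measure.ae_smul_measure hp _

end Dilation

/-! ### Boundedness and cancellation of the symbol -/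

section Symbol

variable {d : ℕ} {Ω : EuclideanSpace ℝ (Fin d) → ℝ}

lemma IsCZSymbol.neg (hΩ : IsCZSymbol Ω) : IsCZSymbol (fun x => -Ω x) where
  homogeneous r hr x hx := by rw [hΩ.homogeneous r hr x hx]
  contDiffOn := hΩ.contDiffOn.neg
  mean_zero := by rw [integral_neg, hΩ.mean_zero, neg_zero]

lemma IsCZSymbol.exists_bound (hΩ : IsCZSymbol Ω) :
    ∃ B : ℝ, 0 < B ∧ ∀ x, x ≠ 0 → |Ω x| ≤ B := by
  have hc : ContinuousOn Ω (Metric.sphere 0 1) :=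
    hΩ.contDiffOn.continuousOn.mono fun x hx => by
      rintro rfl
      simp at hx
  obtain ⟨B, hB⟩ := (isCompact_sphere (0 : EuclideanSpace ℝ (Fin d)) 1).exists_bound_of_continuousOn hc
  refine ⟨max B 1, by positivity, fun x hx => ?_⟩
  have hx' : 0 < ‖x‖ := norm_pos_iff.2 hx
  rw [← hΩ.homogeneous ‖x‖⁻¹ (inv_pos.2 hx') x hx]
  refine (hB _ ?_).trans (le_max_left _ _)
  simp [norm_smul, hx'.ne']

/-- The symbol times a radial function has integral zero. -/
lemma IsCZSymbol.integral_mul_radial (hΩ : IsCZSymbol Ω) [Nontrivial (EuclideanSpace ℝ (Fin d))]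
    (φ : ℝ → ℝ) : ∫ x, Ω x * φ ‖x‖ = 0 := by
  have key := (volume : Measure (EuclideanSpace ℝ (Fin d))).measurePreserving_homeomorphUnitSphereProd.integral_comp
        (Homeomorph.measurableEmbedding _) (fun z => Ω z.1 * φ z.2.1)
  rw [integral_prod_mul (fun z : Metric.sphere (0 : EuclideanSpace ℝ (Fin d)) 1 => Ω z)
    (fun r : Set.Ioi (0 : ℝ) => φ r), hΩ.mean_zero, zero_mul] at key
  rw [← restrict_compl_singleton (μ := volume) (0 : EuclideanSpace ℝ (Fin d)),
    ← integral_subtype_comap (measurableSet_singleton _).compl fun x ↦ Ω x * φ ‖x‖]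
  refine Eq.trans ?_ key
  congr 1
  ext x
  have hx : (x : EuclideanSpace ℝ (Fin d)) ≠ 0 := x.2
  simp [hΩ.homogeneous _ (inv_pos.2 (norm_pos_iff.2 hx)) _ hx]

end Symbol

/-! ### Principal values: algebra, dilation invariance, existence for balls -/

section PrincipalValue

variable {d : ℕ} {Ω f g : EuclideanSpace ℝ (Fin d) → ℝ} {x : EuclideanSpace ℝ (Fin d)}

lemma measurableSet_lt_norm_sub (ε : ℝ) (x : EuclideanSpace ℝ (Fin d)) :
    MeasurableSet {y | ε < ‖x - y‖} :=
  measurableSet_lt measurable_const (by fun_prop)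

lemma abs_czKernel_le {B : ℝ} (hB : ∀ x, x ≠ 0 → |Ω x| ≤ B) {ε : ℝ} (hε : 0 < ε)
    {x y : EuclideanSpace ℝ (Fin d)} (h : ε ≤ ‖x - y‖) : |czKernel Ω x y| ≤ B / ε ^ d := by
  have hne : x - y ≠ 0 := norm_pos_iff.1 (hε.trans_le h)
  have := hB _ hne
  rw [czKernel, abs_div, abs_of_nonneg (pow_nonneg (norm_nonneg _) d)]
  have hB0 : 0 ≤ B := (abs_nonneg _).trans this
  gcongr

lemma aestronglyMeasurable_czKernel (hΩ : IsCZSymbol Ω) {ε : ℝ} (hε : 0 < ε)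
    (x : EuclideanSpace ℝ (Fin d)) :
    AEStronglyMeasurable (czKernel Ω x) (volume.restrict {y | ε < ‖x - y‖}) := by
  refine ContinuousOn.aestronglyMeasurable ?_ (measurableSet_lt_norm_sub ε x)
  have hne : ∀ y ∈ {y | ε < ‖x - y‖}, x - y ∈ ({0}ᶜ : Set (EuclideanSpace ℝ (Fin d))) :=
    fun y hy => norm_pos_iff.1 (hε.trans hy)
  refine ContinuousOn.div (hΩ.contDiffOn.continuousOn.comp (by fun_prop) hne) (by fun_prop) ?_
  intro y hy
  exact pow_ne_zero _ (norm_ne_zero_iff.2 (hne y hy))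

lemma integrableOn_czKernel_mul (hΩ : IsCZSymbol Ω) (hf : Integrable f) {ε : ℝ} (hε : 0 < ε)
    (x : EuclideanSpace ℝ (Fin d)) :
    IntegrableOn (fun y => czKernel Ω x y * f y) {y | ε < ‖x - y‖} := by
  obtain ⟨B, -, hB⟩ := hΩ.exists_bound
  refine Integrable.bdd_mul (c := B / ε ^ d) hf.integrableOn (aestronglyMeasurable_czKernel hΩ hε x) ?_
  refine (ae_restrict_iff' (measurableSet_lt_norm_sub ε x)).2 (ae_of_all _ fun y hy => ?_)
  exact abs_czKernel_le hB hε (le_of_lt hy)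

lemma HasPrincipalValue.czOperator_eq {l : ℝ} (h : HasPrincipalValue Ω f x l) :
    czOperator Ω f x = l :=
  h.2.limUnder_eq

lemma HasPrincipalValue.neg_symbol {l : ℝ} (h : HasPrincipalValue Ω f x l) :
    HasPrincipalValue (fun z => -Ω z) f x (-l) := by
  have hk : ∀ y, czKernel (fun z => -Ω z) x y * f y = -(czKernel Ω x y * f y) := fun y => by
    simp only [czKernel]; ring
  refine ⟨fun ε hε => ?_, ?_⟩
  · simp only [hk]
    exact (h.1 ε hε).neg
  · have : (fun ε => czTruncated (fun z => -Ω z) f ε x) = fun ε => -czTruncated Ω f ε x := by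
      ext ε
      simp only [czTruncated, hk, integral_neg]
    rw [this]
    exact h.2.neg

lemma hasPrincipalValue_zero : HasPrincipalValue Ω (fun _ => 0) x 0 := by
  constructor
  · intro ε _
    simp
  · simp [czTruncated]

lemma HasPrincipalValue.add {k l : ℝ} (hf : HasPrincipalValue Ω f x k)
    (hg : HasPrincipalValue Ω g x l) : HasPrincipalValue Ω (fun y => f y + g y) x (k + l) := by
  constructor
  · intro ε hε
    simp only [mul_add]
    exact (hf.1 ε hε).add (hg.1 ε hε)
  · refine (hf.2.add hg.2).congr' ?_
    filter_upwards [self_mem_nhdsWithin] with ε hε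
    simp only [czTruncated, mul_add]
    rw [integral_add (hf.1 ε hε) (hg.1 ε hε)]

lemma HasPrincipalValue.sum {ι : Type*} (s : Finset ι) {F : ι → EuclideanSpace ℝ (Fin d) → ℝ}
    {l : ι → ℝ} (h : ∀ i ∈ s, HasPrincipalValue Ω (F i) x (l i)) :
    HasPrincipalValue Ω (fun y => ∑ i ∈ s, F i y) x (∑ i ∈ s, l i) := by
  classical
  induction s using Finset.induction_on with
  | empty => simpa using hasPrincipalValue_zero
  | insert a s ha ih =>
    simp only [Finset.sum_insert ha]
    exact (h a (by simp)).add (ih fun i hi => h i (by simp [hi]))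

lemma czKernel_affine (hd : d ≠ 0) (hΩ : IsCZSymbol Ω) {ρ : ℝ} (hρ : 0 < ρ)
    (c y z : EuclideanSpace ℝ (Fin d)) :
    czKernel Ω (c + ρ • y) (c + ρ • z) = (ρ ^ d)⁻¹ * czKernel Ω y z := by
  have h : c + ρ • y - (c + ρ • z) = ρ • (y - z) := by rw [smul_sub]; abel
  rw [czKernel, czKernel, h, norm_smul, Real.norm_of_nonneg hρ.le, mul_pow]
  -- Homogeneity says nothing at the origin; there both sides are quotients by `0 ^ d = 0`, hence
  -- zero.
  by_cases hyz : y - z = 0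
  · simp [hyz, hd]
  · rw [hΩ.homogeneous ρ hρ _ hyz]
    have : ‖y - z‖ ^ d ≠ 0 := pow_ne_zero _ (norm_ne_zero_iff.2 hyz)
    field_simp

lemma indicator_czKernel_transport (hd : d ≠ 0) (hΩ : IsCZSymbol Ω) {ρ : ℝ} (hρ : 0 < ρ)
    (c y : EuclideanSpace ℝ (Fin d)) (ε : ℝ) :
    {z | ε < ‖c + ρ • y - z‖}.indicator
        (fun z => czKernel Ω (c + ρ • y) z * transport c ρ f z) =
      transport c ρ ({z | ε / ρ < ‖y - z‖}.indicator
        (fun z => (ρ ^ d)⁻¹ * (czKernel Ω y z * f z))) := by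
  ext z
  obtain ⟨z, rfl⟩ : ∃ z', z = c + ρ • z' := ⟨_, (affine_inverse hρ c z).symm⟩
  rw [transport_apply_affine hρ]
  have h : c + ρ • y - (c + ρ • z) = ρ • (y - z) := by rw [smul_sub]; abel
  simp only [Set.indicator_apply, Set.mem_ofPred_eq, h, norm_smul, Real.norm_of_nonneg hρ.le,
    div_lt_iff₀' hρ, czKernel_affine hd hΩ hρ, transport_apply_affine hρ, mul_assoc]

/-- Principal values are invariant under translations and dilations. -/
lemma HasPrincipalValue.transport (hd : d ≠ 0) (hΩ : IsCZSymbol Ω) {ρ : ℝ} (hρ : 0 < ρ)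
    (c : EuclideanSpace ℝ (Fin d)) {y : EuclideanSpace ℝ (Fin d)} {l : ℝ}
    (h : HasPrincipalValue Ω f y l) :
    HasPrincipalValue Ω (transport c ρ f) (c + ρ • y) l := by
  have hρd : ρ ^ d ≠ 0 := pow_ne_zero _ hρ.ne'
  constructor
  · intro ε hε
    rw [← integrable_indicator_iff (measurableSet_lt_norm_sub ε _),
      indicator_czKernel_transport hd hΩ hρ]
    refine integrable_transport hρ c ?_
    rw [integrable_indicator_iff (measurableSet_lt_norm_sub _ _)]
    exact (h.1 (ε / ρ) (div_pos hε hρ)).const_mul _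
  · have ht : ∀ ε, czTruncated Ω (MuckenhouptWheeden.transport c ρ f) ε (c + ρ • y) =
        czTruncated Ω f (ε / ρ) y := by
      intro ε
      rw [czTruncated, czTruncated, ← integral_indicator (measurableSet_lt_norm_sub ε _),
        indicator_czKernel_transport hd hΩ hρ, integral_transport hρ,
        integral_indicator (measurableSet_lt_norm_sub _ _), integral_const_mul, ← mul_assoc,
        mul_inv_cancel₀ hρd, one_mul]
    simp only [ht]
    refine h.2.comp ?_
    refine tendsto_nhdsWithin_iff.2 ⟨?_, ?_⟩
    · have : Tendsto (fun ε : ℝ => ε / ρ) (𝓝 0) (𝓝 (0 / ρ)) := tendsto_id.div_const ρ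
      rw [zero_div] at this
      exact this.mono_left nhdsWithin_le_nhds
    · filter_upwards [self_mem_nhdsWithin] with ε hε
      exact div_pos hε hρ

/-- Off the support the principal value is an absolutely convergent integral. -/
lemma hasPrincipalValue_of_separated (hΩ : IsCZSymbol Ω) (hf : Integrable f) {r : ℝ} (hr : 0 < r)
    (h : ∀ y, f y ≠ 0 → r ≤ ‖x - y‖) :
    HasPrincipalValue Ω f x (∫ y, czKernel Ω x y * f y) := by
  refine ⟨fun ε hε => integrableOn_czKernel_mul hΩ hf hε x, ?_⟩
  refine tendsto_const_nhds.congr' ?_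
  filter_upwards [Ioo_mem_nhdsGT hr] with ε hε
  rw [czTruncated, setIntegral_eq_integral_of_forall_compl_eq_zero]
  intro y hy
  by_contra hne
  exact hy (hε.2.trans_le (h y (right_ne_zero_of_mul hne)))

lemma integrable_czKernel_mul_of_separated (hΩ : IsCZSymbol Ω) (hf : Integrable f) {r : ℝ}
    (hr : 0 < r) (h : ∀ y, f y ≠ 0 → r ≤ ‖x - y‖) :
    Integrable (fun y => czKernel Ω x y * f y) := by
  rw [← integrableOn_iff_integrable_of_support_subset (s := {y | r / 2 < ‖x - y‖})]
  · exact integrableOn_czKernel_mul hΩ hf (half_pos hr) x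
  · intro y hy
    exact (half_lt_self hr).trans_le (h y (right_ne_zero_of_mul hy))

lemma abs_integral_czKernel_mul_le {B : ℝ} (hB : ∀ x, x ≠ 0 → |Ω x| ≤ B) (hf : Integrable f)
    (hf0 : ∀ y, 0 ≤ f y) {r : ℝ} (hr : 0 < r) (h : ∀ y, f y ≠ 0 → r ≤ ‖x - y‖) :
    |∫ y, czKernel Ω x y * f y| ≤ B / r ^ d * ∫ y, f y := by
  rw [← integral_const_mul, ← Real.norm_eq_abs]
  refine norm_integral_le_of_norm_le (hf.const_mul _) (ae_of_all _ fun y => ?_)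
  rw [Real.norm_eq_abs, abs_mul, abs_of_nonneg (hf0 y)]
  by_cases hy : f y = 0
  · simp [hy]
  · exact mul_le_mul_of_nonneg_right (abs_czKernel_le hB hr (h y hy)) (hf0 y)

lemma setIntegral_czKernel_annulus [Nontrivial (EuclideanSpace ℝ (Fin d))] (hΩ : IsCZSymbol Ω)
    (x : EuclideanSpace ℝ (Fin d)) (ε δ : ℝ) :
    ∫ y in {y | ε < ‖x - y‖ ∧ ‖x - y‖ ≤ δ}, czKernel Ω x y = 0 := by
  have hm : MeasurableSet {y | ε < ‖x - y‖ ∧ ‖x - y‖ ≤ δ} :=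
    (measurableSet_lt_norm_sub ε x).inter
      (measurableSet_le (f := fun y => ‖x - y‖) (by fun_prop) measurable_const)
  rw [← integral_indicator hm]
  have h : {y | ε < ‖x - y‖ ∧ ‖x - y‖ ≤ δ}.indicator (fun y => czKernel Ω x y) =
      fun y => (fun z => Ω z * (Set.Ioc ε δ).indicator (fun r => (r ^ d)⁻¹) ‖z‖) (x - y) := by
    ext y
    simp [Set.indicator_apply, czKernel, div_eq_mul_inv]
  rw [h, integral_sub_left_eq_self
    (fun z => Ω z * (Set.Ioc ε δ).indicator (fun r => (r ^ d)⁻¹) ‖z‖) volume x,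
    hΩ.integral_mul_radial]

/-- The indicator is constant near an interior point and `Ω` has mean zero, so thin annuli
contribute nothing: the truncations stop changing once `ε` is below half the distance to the
boundary. -/
lemma hasPrincipalValue_ball_of_mem [Nontrivial (EuclideanSpace ℝ (Fin d))] (hΩ : IsCZSymbol Ω)
    {c : EuclideanSpace ℝ (Fin d)} {r : ℝ} (hx : x ∈ Metric.ball c r) :
    ∃ l, HasPrincipalValue Ω ((Metric.ball c r).indicator fun _ => 1) x l := by
  have hf : Integrable ((Metric.ball c r).indicator fun _ => (1 : ℝ)) :=
    (integrable_indicator_iff measurableSet_ball).2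
      (integrableOn_const measure_ball_lt_top.ne)
  set f := (Metric.ball c r).indicator fun _ => (1 : ℝ) with hfdef
  set δ := r - dist x c with hδ
  have hδ0 : 0 < δ := sub_pos.2 hx
  refine ⟨czTruncated Ω f (δ / 2) x, fun ε hε => integrableOn_czKernel_mul hΩ hf hε x, ?_⟩
  refine tendsto_const_nhds.congr' ?_
  filter_upwards [Ioo_mem_nhdsGT (half_pos hδ0)] with ε hε
  have hm : MeasurableSet {y | ε < ‖x - y‖ ∧ ‖x - y‖ ≤ δ / 2} :=
    (measurableSet_lt_norm_sub ε x).inter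
      (measurableSet_le (f := fun y => ‖x - y‖) (by fun_prop) measurable_const)
  have hu : {y | ε < ‖x - y‖} =
      {y | ε < ‖x - y‖ ∧ ‖x - y‖ ≤ δ / 2} ∪ {y | δ / 2 < ‖x - y‖} := by
    ext y
    simp only [Set.mem_ofPred_eq, Set.mem_union]
    constructor
    · intro h
      rcases le_or_gt ‖x - y‖ (δ / 2) with h' | h'
      · exact Or.inl ⟨h, h'⟩
      · exact Or.inr h'
    · rintro (h | h)
      · exact h.1
      · exact hε.2.trans h
  have hI := integrableOn_czKernel_mul hΩ hf hε.1 x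
  rw [czTruncated, czTruncated, hu, setIntegral_union ?_ (measurableSet_lt_norm_sub _ x)
    (hI.mono_set fun y hy => hy.1) (integrableOn_czKernel_mul hΩ hf (half_pos hδ0) x),
    setIntegral_congr_fun (g := fun y => czKernel Ω x y) hm, setIntegral_czKernel_annulus hΩ,
    zero_add]
  · intro y hy
    have : y ∈ Metric.ball c r := by
      have h1 := dist_triangle y x c
      have h2 : dist y x ≤ δ / 2 := by rw [dist_comm, dist_eq_norm]; exact hy.2
      rw [Metric.mem_ball]
      linarith
    simp [hfdef, this]
  · rw [Set.disjoint_left]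
    intro y hy hy'
    exact absurd hy' (not_lt.2 hy.2)

lemma ae_hasPrincipalValue_ball [Nontrivial (EuclideanSpace ℝ (Fin d))] (hΩ : IsCZSymbol Ω)
    (c : EuclideanSpace ℝ (Fin d)) (r : ℝ) :
    ∀ᵐ x, ∃ l, HasPrincipalValue Ω ((Metric.ball c r).indicator fun _ => 1) x l := by
  have hs : ∀ᵐ x : EuclideanSpace ℝ (Fin d), x ∉ Metric.sphere c r :=
    measure_eq_zero_iff_ae_notMem.1 (Measure.addHaar_sphere volume c r)
  filter_upwards [hs] with x hx
  rcases lt_or_gt_of_ne (show dist x c ≠ r from hx) with h | h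
  · exact hasPrincipalValue_ball_of_mem hΩ h
  · refine ⟨_, hasPrincipalValue_of_separated (r := dist x c - r) hΩ
      ((integrable_indicator_iff measurableSet_ball).2
        (integrableOn_const measure_ball_lt_top.ne)) (sub_pos.2 h) fun y hy => ?_⟩
    have hy' : y ∈ Metric.ball c r := Set.mem_of_indicator_ne_zero hy
    have := dist_triangle x y c
    rw [Metric.mem_ball] at hy'
    rw [← dist_eq_norm]
    linarith

end PrincipalValue

/-! ### Geometric sums, scales and densities -/

section Geometric

lemma sum_geometric_le_two (s : Finset ℕ) {q : ℝ} (hq0 : 0 ≤ q) (hq : q ≤ 1 / 2) :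
    ∑ j ∈ s, q ^ j ≤ 2 := by
  have hq1 : q < 1 := by linarith
  calc ∑ j ∈ s, q ^ j ≤ ∑' j, q ^ j :=
        (summable_geometric_of_lt_one hq0 hq1).sum_le_tsum s fun j _ => pow_nonneg hq0 j
    _ = (1 - q)⁻¹ := tsum_geometric_of_lt_one hq0 hq1
    _ ≤ 2 := by
        rw [inv_le_comm₀ (by linarith) (by norm_num)]
        linarith

/-- A geometric sum with ratio at most `1 / 2` is at most twice its largest term; factoring out the
smallest exponent reduces to the full series. -/
lemma sum_geometric_tail_le (s : Finset ℕ) {q L : ℝ} (hq0 : 0 ≤ q) (hq : q ≤ 1 / 2)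
    (hL : 0 ≤ L) (h : ∀ j ∈ s, q ^ j ≤ L) : ∑ j ∈ s, q ^ j ≤ 2 * L := by
  rcases s.eq_empty_or_nonempty with rfl | hs
  · simpa using hL
  set k := s.min' hs
  have h1 : ∑ j ∈ s, q ^ j = q ^ k * ∑ j ∈ s.image (fun j => j - k), q ^ j := by
    rw [Finset.sum_image, Finset.mul_sum]
    · refine Finset.sum_congr rfl fun j hj => ?_
      rw [← pow_add, Nat.add_sub_cancel' (s.min'_le j hj)]
    · intro a ha b hb hab
      have h1 := s.min'_le a ha
      have h2 := s.min'_le b hb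
      simp only at hab
      omega
  rw [h1]
  have h2 := sum_geometric_le_two (s.image fun j => j - k) hq0 hq
  have h3 := h k (s.min'_mem hs)
  have h4 : 0 ≤ q ^ k := pow_nonneg hq0 k
  nlinarith

/-- The scale of the `j`-th child cell. -/
def scale (j : ℕ) : ℝ := (1 / 4) ^ j

lemma scale_pos (j : ℕ) : 0 < scale j := by unfold scale; positivity

lemma scale_le_one (j : ℕ) : scale j ≤ 1 := pow_le_one₀ (by norm_num) (by norm_num)

lemma scale_le_of_lt {i j : ℕ} (h : i < j) : scale j ≤ scale i / 4 := by
  have : (1 / 4 : ℝ) ^ j ≤ (1 / 4) ^ (i + 1) :=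
    pow_le_pow_of_le_one (by norm_num) (by norm_num) h
  unfold scale
  rw [pow_succ] at this
  linarith

lemma scale_pow (d j : ℕ) : scale j ^ d = ((1 / 4 : ℝ) ^ d) ^ j := by
  rw [scale, ← pow_mul, ← pow_mul, mul_comm]

lemma quarter_pow_le {d : ℕ} (hd : d ≠ 0) : (1 / 4 : ℝ) ^ d ≤ 1 / 2 :=
  (pow_le_of_le_one (by norm_num) (by norm_num) hd).trans (by norm_num)

lemma half_pow_le {d : ℕ} (hd : d ≠ 0) : (1 / 2 : ℝ) ^ d ≤ 1 / 2 :=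
  pow_le_of_le_one (by norm_num) (by norm_num) hd

/-- The total volume of the child cells, up to a factor. -/
def scaleSum (d m : ℕ) : ℝ := ∑ j ∈ Finset.range m, scale j ^ d

lemma scaleSum_le_two {d : ℕ} (hd : d ≠ 0) (m : ℕ) : scaleSum d m ≤ 2 := by
  simp only [scaleSum, scale_pow]
  exact sum_geometric_le_two _ (by positivity) (quarter_pow_le hd)

lemma one_le_scaleSum (d : ℕ) {m : ℕ} (hm : m ≠ 0) : 1 ≤ scaleSum d m := by
  have : scale 0 ^ d ≤ scaleSum d m :=
    Finset.single_le_sum (f := fun j => scale j ^ d) (fun j _ => pow_nonneg (scale_pos j).le d)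
      (Finset.mem_range.2 (Nat.pos_of_ne_zero hm))
  simpa [scale] using this

/-- The growth factor of the density of the weight from one generation to the next. -/
def densityRatio (d m : ℕ) (δ : ℝ) : ℝ := (δ ^ d * scaleSum d m)⁻¹

lemma densityRatio_pos (d : ℕ) {m : ℕ} (hm : m ≠ 0) {δ : ℝ} (hδ : 0 < δ) :
    0 < densityRatio d m δ := by
  have := one_le_scaleSum d hm
  unfold densityRatio
  positivity

lemma one_le_densityRatio {d m : ℕ} (hd : d ≠ 0) (hm : m ≠ 0) {δ : ℝ} (hδ : 0 < δ)
    (hδ' : δ ≤ 1 / 16) : 1 ≤ densityRatio d m δ := by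
  have h1 := one_le_scaleSum d hm
  have h2 := scaleSum_le_two hd m
  have h3 : δ ^ d ≤ δ := pow_le_of_le_one hδ.le (by linarith) hd
  have h4 : 0 < δ ^ d := by positivity
  rw [densityRatio, one_le_inv₀ (by positivity)]
  nlinarith

lemma densityRatio_mul_sum (d : ℕ) {m : ℕ} (hm : m ≠ 0) {δ : ℝ} (hδ : 0 < δ) :
    densityRatio d m δ * ∑ j ∈ Finset.range m, (δ * scale j) ^ d = 1 := by
  have h1 := one_le_scaleSum d hm
  simp only [mul_pow, ← Finset.mul_sum]
  exact inv_mul_cancel₀ (by unfold scaleSum at h1; positivity)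

end Geometric

/-! ### Separation of the children from each other and from the core -/

section Separation

variable {d : ℕ} {e : EuclideanSpace ℝ (Fin d)} {δ : ℝ}

lemma norm_child_sub_le (hδ : 0 < δ) (hδ' : δ ≤ 1 / 16) (j : ℕ)
    {y : EuclideanSpace ℝ (Fin d)} (hy : ‖y‖ ≤ 2) :
    ‖scale j • e + (δ * scale j) • y - scale j • e‖ ≤ scale j / 8 := by
  have := scale_pos j
  rw [add_sub_cancel_left, norm_smul, Real.norm_of_nonneg (by positivity)]
  nlinarith [mul_le_mul hδ' hy (norm_nonneg _) (by norm_num), norm_nonneg y]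

lemma norm_child_le (he : ‖e‖ = 1) (hδ : 0 < δ) (hδ' : δ ≤ 1 / 16) (j : ℕ)
    {y : EuclideanSpace ℝ (Fin d)} (hy : ‖y‖ ≤ 2) :
    ‖scale j • e + (δ * scale j) • y‖ ≤ 2 := by
  have h1 := norm_child_sub_le (e := e) hδ hδ' j hy
  have h2 := scale_le_one j
  have h3 : ‖scale j • e‖ = scale j := by
    rw [norm_smul, he, mul_one, Real.norm_of_nonneg (scale_pos j).le]
  have h4 := norm_le_norm_add_norm_sub' (scale j • e + (δ * scale j) • y) (scale j • e)
  linarith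

/-- The centres are at least `3 / 4 * scale i` apart, and the two cells deviate from them by at most
`scale i / 8` and `scale j / 8 ≤ scale i / 32`. -/
lemma child_separated_of_lt (he : ‖e‖ = 1) (hδ : 0 < δ) (hδ' : δ ≤ 1 / 16) {i j : ℕ} (hij : i < j)
    {y z : EuclideanSpace ℝ (Fin d)} (hy : ‖y‖ ≤ 2) (hz : ‖z‖ ≤ 2) :
    scale i / 2 ≤
      ‖scale i • e + (δ * scale i) • y - (scale j • e + (δ * scale j) • z)‖ := by
  have h1 := norm_child_sub_le (e := e) hδ hδ' i hy
  have h2 := norm_child_sub_le (e := e) hδ hδ' j hz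
  have h3 := scale_le_of_lt hij
  have h4 : ‖scale i • e - scale j • e‖ = scale i - scale j := by
    rw [← sub_smul, norm_smul, he, mul_one, Real.norm_of_nonneg]
    have := scale_pos i
    linarith
  set a := scale i • e + (δ * scale i) • y
  set b := scale j • e + (δ * scale j) • z
  have h5 : ‖scale i • e - scale j • e‖ ≤ ‖a - scale i • e‖ + ‖a - b‖ + ‖b - scale j • e‖ := by
    have : scale i • e - scale j • e = -(a - scale i • e) + (a - b) + (b - scale j • e) := by abel
    rw [this]
    refine (norm_add_le _ _).trans (add_le_add_left ((norm_add_le _ _).trans ?_) _)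
    rw [norm_neg]
  have := scale_pos i
  linarith

lemma child_separated (he : ‖e‖ = 1) (hδ : 0 < δ) (hδ' : δ ≤ 1 / 16) {i j : ℕ} (hij : i ≠ j)
    {y z : EuclideanSpace ℝ (Fin d)} (hy : ‖y‖ ≤ 2) (hz : ‖z‖ ≤ 2) :
    scale i / 2 ≤ ‖scale i • e + (δ * scale i) • y - (scale j • e + (δ * scale j) • z)‖ ∧
    scale j / 2 ≤ ‖scale i • e + (δ * scale i) • y - (scale j • e + (δ * scale j) • z)‖ := by
  rcases lt_or_gt_of_ne hij with h | h
  · have h1 := child_separated_of_lt he hδ hδ' h hy hz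
    have h2 := scale_le_of_lt h
    have h3 := scale_pos i
    exact ⟨h1, by linarith⟩
  · have h1 := child_separated_of_lt he hδ hδ' h hz hy
    rw [norm_sub_rev] at h1
    have h2 := scale_le_of_lt h
    have h3 := scale_pos j
    exact ⟨by linarith, h1⟩

lemma core_separated (he : ‖e‖ = 1) (hδ : 0 < δ) (hδ' : δ ≤ 1 / 16) {m j : ℕ} (hj : j < m)
    {x z : EuclideanSpace ℝ (Fin d)} (hx : ‖x‖ < δ * scale m) (hz : ‖z‖ ≤ 2) :
    scale j / 2 ≤ ‖x - (scale j • e + (δ * scale j) • z)‖ := by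
  have h1 := norm_child_sub_le (e := e) hδ hδ' j hz
  have h3 := scale_le_of_lt hj
  have h4 : ‖scale j • e‖ = scale j := by
    rw [norm_smul, he, mul_one, Real.norm_of_nonneg (scale_pos j).le]
  set b := scale j • e + (δ * scale j) • z
  have h5 : ‖scale j • e‖ ≤ ‖x‖ + ‖x - b‖ + ‖b - scale j • e‖ := by
    have : scale j • e = x - (x - b) - (b - scale j • e) := by abel
    nth_rw 1 [this]
    exact (norm_sub_le _ _).trans (add_le_add_left (norm_sub_le _ _) _)
  have h6 := scale_pos m
  have h7 : δ * scale m ≤ 1 / 16 * scale m := by gcongr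
  have := scale_pos j
  linarith

end Separation

/-! ### Cubes and the maximal function -/

section Cubes

variable {d : ℕ}

lemma measurableSet_cube (a : EuclideanSpace ℝ (Fin d)) (r : ℝ) : MeasurableSet (cube a r) := by
  have : cube a r = ⋂ i, {y | a i ≤ y i ∧ y i ≤ a i + r} := by
    ext y; simp [cube]
  rw [this]
  refine MeasurableSet.iInter fun i => MeasurableSet.inter ?_ ?_
  · exact measurableSet_le measurable_const (f := fun _ => a i)
      (g := fun y : EuclideanSpace ℝ (Fin d) => y i) (by fun_prop)
  · exact measurableSet_le (f := fun y : EuclideanSpace ℝ (Fin d) => y i) (by fun_prop)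
      measurable_const

lemma volume_cube (a : EuclideanSpace ℝ (Fin d)) {r : ℝ} (hr : 0 ≤ r) :
    volume (cube a r) = ENNReal.ofReal (r ^ d) := by
  have h1 : cube a r = (WithLp.ofLp : EuclideanSpace ℝ (Fin d) → Fin d → ℝ) ⁻¹'
      Set.Icc (fun i => a i) (fun i => a i + r) := by
    ext y
    simp [cube, Pi.le_def, forall_and]
  rw [h1, (PiLp.volume_preserving_ofLp (Fin d)).measure_preimage measurableSet_Icc.nullMeasurableSet,
    Real.volume_Icc_pi]
  simp [ENNReal.ofReal_pow hr]

/-- The crude factor `d` in place of `√d` avoids square roots; it is the source of the factor `(2 *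
d) ^ d` in `coreConst`. -/
lemma norm_sub_le_of_mem_cube {a x y : EuclideanSpace ℝ (Fin d)} {r : ℝ} (hr : 0 ≤ r)
    (hx : x ∈ cube a r) (hy : y ∈ cube a r) : ‖x - y‖ ≤ d * r := by
  have h1 : ∀ i, ‖(x - y) i‖ ≤ r := fun i => by
    have hxi := hx i
    have hyi := hy i
    rw [Real.norm_eq_abs, abs_le, PiLp.sub_apply]
    constructor <;> linarith
  have h2 : ‖x - y‖ ^ 2 ≤ (d * r) ^ 2 := by
    rw [EuclideanSpace.norm_sq_eq]
    calc ∑ i, ‖(x - y) i‖ ^ 2 ≤ ∑ _i : Fin d, r ^ 2 :=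
          Finset.sum_le_sum fun i _ => pow_le_pow_left₀ (norm_nonneg _) (h1 i) 2
      _ = d * r ^ 2 := by simp
      _ ≤ (d * r) ^ 2 := by
          have : (d : ℝ) ≤ (d : ℝ) ^ 2 := by exact_mod_cast Nat.le_self_pow two_ne_zero d
          nlinarith [sq_nonneg r]
  exact le_of_sq_le_sq h2 (by positivity)

lemma affine_mem_cube {ρ : ℝ} (hρ : 0 < ρ) (c a z : EuclideanSpace ℝ (Fin d)) (r : ℝ) :
    c + ρ • z ∈ cube a r ↔ z ∈ cube (ρ⁻¹ • (a - c)) (r / ρ) := by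
  simp only [cube, Set.mem_ofPred_eq, PiLp.add_apply, PiLp.smul_apply, PiLp.sub_apply, smul_eq_mul]
  refine forall_congr' fun i => and_congr ?_ ?_
  · rw [inv_mul_le_iff₀ hρ]
    constructor <;> intro h <;> linarith
  · rw [inv_mul_eq_div, ← add_div, le_div_iff₀ hρ]
    constructor <;> intro h <;> linarith

lemma setLIntegral_cube_transport {ρ : ℝ} (hρ : 0 < ρ) (c a : EuclideanSpace ℝ (Fin d)) (r : ℝ)
    (w : EuclideanSpace ℝ (Fin d) → ℝ≥0∞) :
    ∫⁻ x in cube a r, transport c ρ w x =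
      ENNReal.ofReal (ρ ^ d) * ∫⁻ x in cube (ρ⁻¹ • (a - c)) (r / ρ), w x := by
  rw [← lintegral_indicator (measurableSet_cube _ _), ← lintegral_indicator (measurableSet_cube _ _),
    ← lintegral_transport hρ c]
  congr 1
  classical
  ext x
  obtain ⟨z, rfl⟩ : ∃ z, x = c + ρ • z := ⟨_, (affine_inverse hρ c x).symm⟩
  simp only [transport_apply_affine hρ, Set.indicator_apply, affine_mem_cube hρ]

lemma maximalFunction_le {w : EuclideanSpace ℝ (Fin d) → ℝ≥0∞} {x : EuclideanSpace ℝ (Fin d)}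
    {c : ℝ≥0∞} (h : ∀ a r, 0 < r → x ∈ cube a r → ∫⁻ y in cube a r, w y ≤ c * volume (cube a r)) :
    maximalFunction w x ≤ c :=
  iSup_le fun a => iSup_le fun r => iSup_le fun hr => iSup_le fun hx =>
    ENNReal.div_le_of_le_mul (h a r hr hx)

lemma volume_cube_ne_zero (a : EuclideanSpace ℝ (Fin d)) {r : ℝ} (hr : 0 < r) :
    volume (cube a r) ≠ 0 := by
  rw [volume_cube a hr.le]
  simpa using pow_pos hr d

lemma volume_cube_ne_top (a : EuclideanSpace ℝ (Fin d)) {r : ℝ} (hr : 0 < r) :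
    volume (cube a r) ≠ ∞ := by
  rw [volume_cube a hr.le]
  exact ENNReal.ofReal_ne_top

lemma setLIntegral_cube_le {w : EuclideanSpace ℝ (Fin d) → ℝ≥0∞} {a x : EuclideanSpace ℝ (Fin d)}
    {r : ℝ} (hr : 0 < r) (hx : x ∈ cube a r) :
    ∫⁻ y in cube a r, w y ≤ maximalFunction w x * volume (cube a r) := by
  rw [← ENNReal.div_le_iff (volume_cube_ne_zero a hr) (volume_cube_ne_top a hr)]
  exact le_iSup_of_le a (le_iSup_of_le r (le_iSup_of_le hr (le_iSup_of_le hx le_rfl)))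

lemma closedBall_subset_cube {R : ℝ} :
    Metric.closedBall (0 : EuclideanSpace ℝ (Fin d)) R ⊆
      cube (WithLp.toLp 2 fun _ => -R) (2 * R) := by
  intro y hy i
  have h1 : ‖y i‖ ≤ R := (PiLp.norm_apply_le y i).trans (by simpa using hy)
  rw [Real.norm_eq_abs, abs_le] at h1
  simp only
  constructor <;> linarith

/-- A weight of mass one carried by a ball has maximal function bounded below on that ball. -/
lemma le_maximalFunction_of_mem_closedBall {w : EuclideanSpace ℝ (Fin d) → ℝ≥0∞} {R : ℝ}
    (hR : 0 < R) (hw : ∀ y, w y ≠ 0 → ‖y‖ ≤ R) {x : EuclideanSpace ℝ (Fin d)} (hx : ‖x‖ ≤ R) :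
    (∫⁻ y, w y) / ENNReal.ofReal ((2 * R) ^ d) ≤ maximalFunction w x := by
  have h2R : 0 < 2 * R := by positivity
  set a : EuclideanSpace ℝ (Fin d) := WithLp.toLp 2 fun _ => -R
  have h1 : ∫⁻ y in cube a (2 * R), w y = ∫⁻ y, w y := by
    rw [← lintegral_indicator (measurableSet_cube _ _), Set.indicator_eq_self.2]
    intro y hy
    exact closedBall_subset_cube (by simpa using hw y hy)
  rw [← h1, ← volume_cube a h2R.le, ENNReal.div_le_iff (volume_cube_ne_zero a h2R)
    (volume_cube_ne_top a h2R)]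
  exact setLIntegral_cube_le h2R (closedBall_subset_cube (by simpa using hx))

end Cubes

/-! ### The weight of the next generation and its maximal function -/

section NextWeight

variable {d : ℕ}

/-- The weight of the next generation: `m` rescaled copies of `w`, of equal density, placed in the
child cells. -/
def nextWeight (m : ℕ) (e : EuclideanSpace ℝ (Fin d)) (δ : ℝ)
    (w : EuclideanSpace ℝ (Fin d) → ℝ≥0∞) (x : EuclideanSpace ℝ (Fin d)) : ℝ≥0∞ :=
  ENNReal.ofReal (densityRatio d m δ) *
    ∑ j ∈ Finset.range m, transport (scale j • e) (δ * scale j) w x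

variable {m : ℕ} {e : EuclideanSpace ℝ (Fin d)} {δ : ℝ} {w : EuclideanSpace ℝ (Fin d) → ℝ≥0∞}

lemma measurable_nextWeight (hw : Measurable w) : Measurable (nextWeight m e δ w) :=
  (Finset.measurable_fun_sum _ fun _ _ => measurable_transport _ _ hw).const_mul _

lemma transport_ne_zero {α : Type*} [Zero α] {g : EuclideanSpace ℝ (Fin d) → α}
    (hg : ∀ y, g y ≠ 0 → ‖y‖ ≤ 2) {ρ : ℝ} (hρ : 0 < ρ) {c x : EuclideanSpace ℝ (Fin d)}
    (hx : transport c ρ g x ≠ 0) : ∃ y, ‖y‖ ≤ 2 ∧ g y ≠ 0 ∧ x = c + ρ • y :=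
  ⟨ρ⁻¹ • (x - c), hg _ hx, hx, (affine_inverse hρ c x).symm⟩

lemma transport_child_of_ne {α : Type*} [Zero α] {g : EuclideanSpace ℝ (Fin d) → α}
    (hg : ∀ y, g y ≠ 0 → ‖y‖ ≤ 2) (he : ‖e‖ = 1) (hδ : 0 < δ) (hδ' : δ ≤ 1 / 16) {i j : ℕ}
    (hij : j ≠ i) {y : EuclideanSpace ℝ (Fin d)} (hy : ‖y‖ ≤ 2) :
    transport (scale j • e) (δ * scale j) g (scale i • e + (δ * scale i) • y) = 0 := by
  by_contra h
  obtain ⟨z, hz, -, hxz⟩ := transport_ne_zero hg (mul_pos hδ (scale_pos j)) h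
  have := (child_separated he hδ hδ' (Ne.symm hij) hy hz).1
  rw [← hxz, sub_self, norm_zero] at this
  linarith [scale_pos i]

lemma setLIntegral_nextWeight (hw : Measurable w) (s : Set (EuclideanSpace ℝ (Fin d))) :
    ∫⁻ x in s, nextWeight m e δ w x = ENNReal.ofReal (densityRatio d m δ) *
      ∑ j ∈ Finset.range m, ∫⁻ x in s, transport (scale j • e) (δ * scale j) w x := by
  unfold nextWeight
  rw [lintegral_const_mul _ (Finset.measurable_fun_sum _ fun _ _ => measurable_transport _ _ hw),
    lintegral_finsetSum _ fun _ _ => measurable_transport _ _ hw]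

lemma lintegral_nextWeight (hm : m ≠ 0) (hδ : 0 < δ) (hw : Measurable w) :
    ∫⁻ x, nextWeight m e δ w x = ∫⁻ x, w x := by
  rw [← setLIntegral_univ, setLIntegral_nextWeight hw]
  simp only [setLIntegral_univ]
  have : ∀ j ∈ Finset.range m, ∫⁻ x, transport (scale j • e) (δ * scale j) w x =
      ENNReal.ofReal ((δ * scale j) ^ d) * ∫⁻ x, w x := fun j _ =>
    lintegral_transport (mul_pos hδ (scale_pos j)) _ _
  rw [Finset.sum_congr rfl this, ← Finset.sum_mul, ← ENNReal.ofReal_sum_of_nonneg, ← mul_assoc,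
    ← ENNReal.ofReal_mul (densityRatio_pos d hm hδ).le, densityRatio_mul_sum d hm hδ,
    ENNReal.ofReal_one, one_mul]
  intro j _
  exact pow_nonneg (mul_pos hδ (scale_pos j)).le d

lemma nextWeight_ne_zero (hδ : 0 < δ) (hws : ∀ y, w y ≠ 0 → ‖y‖ ≤ 2)
    {x : EuclideanSpace ℝ (Fin d)} (hx : nextWeight m e δ w x ≠ 0) :
    ∃ i ∈ Finset.range m, ∃ y, ‖y‖ ≤ 2 ∧ w y ≠ 0 ∧ x = scale i • e + (δ * scale i) • y := by
  obtain ⟨i, hi, h⟩ := Finset.exists_ne_zero_of_sum_ne_zero (right_ne_zero_of_mul hx)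
  exact ⟨i, hi, transport_ne_zero hws (mul_pos hδ (scale_pos i)) h⟩

lemma nextWeight_child (he : ‖e‖ = 1) (hδ : 0 < δ) (hδ' : δ ≤ 1 / 16)
    (hws : ∀ y, w y ≠ 0 → ‖y‖ ≤ 2) {i : ℕ} (hi : i ∈ Finset.range m)
    {y : EuclideanSpace ℝ (Fin d)} (hy : ‖y‖ ≤ 2) :
    nextWeight m e δ w (scale i • e + (δ * scale i) • y) =
      ENNReal.ofReal (densityRatio d m δ) * w y := by
  rw [nextWeight, Finset.sum_eq_single_of_mem i hi fun j _ hji =>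
    transport_child_of_ne hws he hδ hδ' hji hy, transport_apply_affine (mul_pos hδ (scale_pos i))]

/-- The constant in the bound for the maximal function at the core of a cell. -/
def coreConst (d : ℕ) (δ : ℝ) : ℝ := 2 * (2 * d) ^ d * δ ^ d

lemma coreConst_nonneg (d : ℕ) (hδ : 0 < δ) : 0 ≤ coreConst d δ := by
  unfold coreConst; positivity

/-- A cube that meets only child cells whose scales are at most comparable to its side length
carries at most a multiple of the mass allowed by the density of the new generation. -/
lemma setLIntegral_cube_nextWeight_le (hd : d ≠ 0) (hδ : 0 < δ) (hw : Measurable w)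
    (hws : ∀ y, w y ≠ 0 → ‖y‖ ≤ 2) (hw1 : ∫⁻ x, w x = 1) {a : EuclideanSpace ℝ (Fin d)} {r : ℝ}
    (hr : 0 < r)
    (h : ∀ j ∈ Finset.range m, ∀ z : EuclideanSpace ℝ (Fin d), ‖z‖ ≤ 2 →
      scale j • e + (δ * scale j) • z ∈ cube a r → scale j ≤ 2 * d * r) :
    ∫⁻ x in cube a r, nextWeight m e δ w x ≤
      ENNReal.ofReal (densityRatio d m δ) * ENNReal.ofReal (coreConst d δ) *
        volume (cube a r) := by
  have hterm : ∀ j ∈ Finset.range m,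
      ∫⁻ x in cube a r, transport (scale j • e) (δ * scale j) w x ≤
        if scale j ≤ 2 * d * r then ENNReal.ofReal ((δ * scale j) ^ d) else 0 := by
    intro j hj
    have hρ := mul_pos hδ (scale_pos j)
    split_ifs with hs
    · refine (setLIntegral_le_lintegral _ _).trans ?_
      rw [lintegral_transport hρ, hw1, mul_one]
    · rw [nonpos_iff_eq_zero, ← lintegral_indicator (measurableSet_cube _ _)]
      have : (cube a r).indicator (transport (scale j • e) (δ * scale j) w) = fun _ => 0 := by
        ext x
        rw [Set.indicator_apply_eq_zero]
        intro hx
        by_contra hne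
        obtain ⟨z, hz, -, rfl⟩ := transport_ne_zero hws hρ hne
        exact hs (h j hj z hz hx)
      rw [this, lintegral_zero]
  -- Only scales up to `2 * d * r` count and they are geometric, so the largest one dominates; after
  -- multiplication by `δ ^ d` this is `coreConst d δ * r ^ d`.
  have hsum : ∑ j ∈ Finset.range m with scale j ≤ 2 * d * r, scale j ^ d ≤ 2 * (2 * d * r) ^ d := by
    simp only [scale_pow]
    refine sum_geometric_tail_le _ (by positivity) (quarter_pow_le hd) (by positivity) ?_
    intro j hj
    rw [← scale_pow]
    exact pow_le_pow_left₀ (scale_pos j).le (Finset.mem_filter.1 hj).2 d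
  rw [setLIntegral_nextWeight hw, mul_assoc, volume_cube a hr.le,
    ← ENNReal.ofReal_mul (coreConst_nonneg d hδ)]
  refine mul_le_mul_right ((Finset.sum_le_sum hterm).trans ?_) _
  rw [← Finset.sum_filter, ← ENNReal.ofReal_sum_of_nonneg
    (fun j _ => pow_nonneg (mul_pos hδ (scale_pos j)).le d)]
  refine ENNReal.ofReal_le_ofReal ?_
  simp only [mul_pow, ← Finset.mul_sum]
  calc δ ^ d * ∑ j ∈ Finset.range m with scale j ≤ 2 * d * r, scale j ^ d
      ≤ δ ^ d * (2 * (2 * d * r) ^ d) := by gcongr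
    _ = coreConst d δ * r ^ d := by
        unfold coreConst
        rw [mul_pow (2 * (d : ℝ)) r]
        ring

/-- The core is at distance at least `scale j / 2` from child `j`, so a cube through a point of the
core that meets this child has `scale j ≤ 2 * d * r`. No cube sees the high densities deep inside a
child without being large compared with its scale. -/
lemma maximalFunction_nextWeight_core_le (hd : d ≠ 0) (he : ‖e‖ = 1) (hδ : 0 < δ)
    (hδ' : δ ≤ 1 / 16) (hw : Measurable w) (hws : ∀ y, w y ≠ 0 → ‖y‖ ≤ 2) (hw1 : ∫⁻ x, w x = 1)
    {x : EuclideanSpace ℝ (Fin d)} (hx : ‖x‖ < δ * scale m) :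
    maximalFunction (nextWeight m e δ w) x ≤
      ENNReal.ofReal (densityRatio d m δ) * ENNReal.ofReal (coreConst d δ) := by
  refine maximalFunction_le fun a r hr hxa =>
    setLIntegral_cube_nextWeight_le hd hδ hw hws hw1 hr fun j hj z hz hzQ => ?_
  have h1 := core_separated he hδ hδ' (Finset.mem_range.1 hj) hx hz
  have h2 := norm_sub_le_of_mem_cube hr.le hxa hzQ
  linarith

/-- A dichotomy for the cube: if it reaches a sibling, it is large and only total masses matter;
otherwise it sees a single copy of `w`, and rescaling gives the old maximal function times the
density factor. -/
lemma maximalFunction_nextWeight_child_le (hd : d ≠ 0) (he : ‖e‖ = 1) (hδ : 0 < δ)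
    (hδ' : δ ≤ 1 / 16) (hw : Measurable w) (hws : ∀ y, w y ≠ 0 → ‖y‖ ≤ 2) (hw1 : ∫⁻ x, w x = 1)
    {i : ℕ} (hi : i ∈ Finset.range m) {y : EuclideanSpace ℝ (Fin d)} (hy : ‖y‖ ≤ 2) :
    maximalFunction (nextWeight m e δ w) (scale i • e + (δ * scale i) • y) ≤
      ENNReal.ofReal (densityRatio d m δ) *
        (ENNReal.ofReal (coreConst d δ) ⊔ maximalFunction w y) := by
  refine maximalFunction_le fun a r hr hxa => ?_
  by_cases hmeet : ∃ j ∈ Finset.range m, j ≠ i ∧ ∃ z : EuclideanSpace ℝ (Fin d), ‖z‖ ≤ 2 ∧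
      scale j • e + (δ * scale j) • z ∈ cube a r
  · obtain ⟨j, -, hji, z, hz, hzQ⟩ := hmeet
    have h1 := (child_separated he hδ hδ' hji.symm hy hz).1
    have h2 := norm_sub_le_of_mem_cube hr.le hxa hzQ
    refine (setLIntegral_cube_nextWeight_le hd hδ hw hws hw1 hr fun k hk u hu huQ => ?_).trans ?_
    -- Separation from the sibling `j` already forces `scale i ≤ 2 * d * r`, so child `i` itself is
    -- also admissible.
    · rcases eq_or_ne k i with rfl | hki
      · linarith
      · have h3 := (child_separated he hδ hδ' hki.symm hy hu).2
        have h4 := norm_sub_le_of_mem_cube hr.le hxa huQ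
        linarith
    · gcongr
      exact le_sup_left
  · push Not at hmeet
    have hρ := mul_pos hδ (scale_pos i)
    have h1 : ∫⁻ x in cube a r, nextWeight m e δ w x = ENNReal.ofReal (densityRatio d m δ) *
        ∫⁻ x in cube a r, transport (scale i • e) (δ * scale i) w x := by
      rw [setLIntegral_nextWeight hw, Finset.sum_eq_single_of_mem i hi]
      intro j hj hji
      rw [← lintegral_indicator (measurableSet_cube _ _)]
      have : (cube a r).indicator (transport (scale j • e) (δ * scale j) w) = fun _ => 0 := by
        ext x
        rw [Set.indicator_apply_eq_zero]
        intro hx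
        by_contra hne
        obtain ⟨z, hz, -, rfl⟩ := transport_ne_zero hws (mul_pos hδ (scale_pos j)) hne
        exact hmeet j hj hji z hz hx
      rw [this, lintegral_zero]
    rw [h1, mul_assoc, setLIntegral_cube_transport hρ]
    refine mul_le_mul_right ?_ _
    have h2 := setLIntegral_cube_le (w := w) (div_pos hr hρ) ((affine_mem_cube hρ _ a y r).1 hxa)
    calc ENNReal.ofReal ((δ * scale i) ^ d) * _ ≤ ENNReal.ofReal ((δ * scale i) ^ d) *
          (maximalFunction w y * volume (cube ((δ * scale i)⁻¹ • (a - scale i • e))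
            (r / (δ * scale i)))) := mul_le_mul_right h2 _
      _ = maximalFunction w y * volume (cube a r) := by
          rw [volume_cube _ (div_pos hr hρ).le, volume_cube _ hr.le, mul_left_comm,
            ← ENNReal.ofReal_mul (pow_nonneg hρ.le d), ← mul_pow, mul_div_cancel₀ _ hρ.ne']
      _ ≤ _ := by
          gcongr
          exact le_sup_right

end NextWeight

/-! ### The function of the next generation and its singular integral -/

section NextFunction

/-- The volume of the unit ball. -/
def unitVolume (d : ℕ) : ℝ := volume.real (Metric.ball (0 : EuclideanSpace ℝ (Fin d)) 1)

lemma unitVolume_pos (d : ℕ) : 0 < unitVolume d :=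
  ENNReal.toReal_pos (Metric.measure_ball_pos _ _ one_pos).ne' measure_ball_lt_top.ne

lemma volume_ball_zero {d : ℕ} {r : ℝ} (hr : 0 < r) :
    volume (Metric.ball (0 : EuclideanSpace ℝ (Fin d)) r) =
      ENNReal.ofReal (unitVolume d * r ^ d) := by
  rw [Measure.addHaar_ball_of_pos _ _ hr, mul_comm, ENNReal.ofReal_mul (unitVolume_pos d).le,
    unitVolume, ofReal_measureReal measure_ball_lt_top.ne]
  simp

variable {d : ℕ}

/-- The indicator function of the core of a cell. -/
def coreIndicator (d : ℕ) (r : ℝ) : EuclideanSpace ℝ (Fin d) → ℝ :=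
  (Metric.ball 0 r).indicator fun _ => 1

/-- The function of the next generation: the indicator of the core plus rescaled copies of `f` in
the child cells. -/
def nextFunction (m : ℕ) (e : EuclideanSpace ℝ (Fin d)) (δ : ℝ)
    (f : EuclideanSpace ℝ (Fin d) → ℝ) (x : EuclideanSpace ℝ (Fin d)) : ℝ :=
  coreIndicator d (δ * scale m) x +
    ∑ j ∈ Finset.range m, transport (scale j • e) (δ * scale j) f x

lemma measurable_coreIndicator (r : ℝ) : Measurable (coreIndicator d r) :=
  measurable_const.indicator measurableSet_ball

lemma coreIndicator_nonneg (r : ℝ) (x : EuclideanSpace ℝ (Fin d)) : 0 ≤ coreIndicator d r x :=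
  Set.indicator_nonneg (fun _ _ => zero_le_one) x

lemma integrable_coreIndicator (r : ℝ) : Integrable (coreIndicator d r) :=
  (integrable_indicator_iff measurableSet_ball).2 (integrableOn_const measure_ball_lt_top.ne)

lemma integral_coreIndicator {r : ℝ} (hr : 0 < r) :
    ∫ x, coreIndicator d r x = unitVolume d * r ^ d := by
  have : 0 ≤ unitVolume d * r ^ d := mul_nonneg (unitVolume_pos d).le (pow_nonneg hr.le d)
  rw [coreIndicator, integral_indicator measurableSet_ball, setIntegral_const, measureReal_def,
    volume_ball_zero hr, ENNReal.toReal_ofReal this, smul_eq_mul, mul_one]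

lemma norm_lt_of_coreIndicator_ne_zero {r : ℝ} {x : EuclideanSpace ℝ (Fin d)}
    (h : coreIndicator d r x ≠ 0) : ‖x‖ < r := by
  simpa using Set.mem_of_indicator_ne_zero h

variable {m : ℕ} {e : EuclideanSpace ℝ (Fin d)} {δ : ℝ} {f : EuclideanSpace ℝ (Fin d) → ℝ}

lemma measurable_nextFunction (hf : Measurable f) : Measurable (nextFunction m e δ f) :=
  (measurable_coreIndicator _).add
    (Finset.measurable_fun_sum _ fun _ _ => measurable_transport _ _ hf)

lemma coreIndicator_le_nextFunction (hf : ∀ x, 0 ≤ f x) (x : EuclideanSpace ℝ (Fin d)) :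
    coreIndicator d (δ * scale m) x ≤ nextFunction m e δ f x :=
  le_add_of_nonneg_right (Finset.sum_nonneg fun _ _ => hf _)

lemma nextFunction_nonneg (hf : ∀ x, 0 ≤ f x) (x : EuclideanSpace ℝ (Fin d)) :
    0 ≤ nextFunction m e δ f x :=
  (coreIndicator_nonneg _ x).trans (coreIndicator_le_nextFunction hf x)

lemma integrable_nextFunction (hδ : 0 < δ) (hf : Integrable f) :
    Integrable (nextFunction m e δ f) :=
  (integrable_coreIndicator _).add (integrable_finsetSum _ fun j _ =>
    integrable_transport (mul_pos hδ (scale_pos j)) _ hf)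

/-- The children have total relative volume `δ ^ d * scaleSum d m ≤ 1 / 8`, and `1 + 2 / 8 ≤ 2`, so
the factor `2` reproduces itself. This keeps the sibling interaction proportional to the core volume
in every generation. -/
lemma integral_nextFunction_le (hd : d ≠ 0) (hδ : 0 < δ) (hδ' : δ ≤ 1 / 16) (hf : Integrable f)
    (h : ∫ x, f x ≤ 2 * (unitVolume d * (δ * scale m) ^ d)) :
    ∫ x, nextFunction m e δ f x ≤ 2 * (unitVolume d * (δ * scale m) ^ d) := by
  have hη : 0 < δ * scale m := mul_pos hδ (scale_pos m)
  have hI : ∀ j ∈ Finset.range m, Integrable (transport (scale j • e) (δ * scale j) f) :=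
    fun j _ => integrable_transport (mul_pos hδ (scale_pos j)) _ hf
  have h1 : ∀ j ∈ Finset.range m, ∫ x, transport (scale j • e) (δ * scale j) f x =
      (δ * scale j) ^ d * ∫ x, f x := fun j _ =>
    integral_transport (mul_pos hδ (scale_pos j)) _ _
  unfold nextFunction
  rw [integral_add (integrable_coreIndicator _) (integrable_finsetSum _ hI),
    integral_coreIndicator hη, integral_finsetSum _ hI, Finset.sum_congr rfl h1, ← Finset.sum_mul]
  simp only [mul_pow δ, ← Finset.mul_sum]
  have h2 : δ ^ d ≤ 1 / 16 := (pow_le_of_le_one hδ.le (by linarith) hd).trans hδ'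
  have h3 := scaleSum_le_two hd m
  have h4 : 0 ≤ scaleSum d m := Finset.sum_nonneg fun j _ => pow_nonneg (scale_pos j).le d
  have h5 : 0 < δ ^ d := by positivity
  have h6 : δ ^ d * scaleSum d m ≤ 1 / 8 := by nlinarith
  have h7 : 0 ≤ δ ^ d * scaleSum d m := by positivity
  have h8 : 0 ≤ unitVolume d * (δ * scale m) ^ d :=
    mul_nonneg (unitVolume_pos d).le (pow_nonneg hη.le d)
  have h9 : δ ^ d * scaleSum d m * ∫ x, f x ≤
      δ ^ d * scaleSum d m * (2 * (unitVolume d * (δ * scale m) ^ d)) := by gcongr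
  have h10 : δ ^ d * scaleSum d m * (2 * (unitVolume d * (δ * scale m) ^ d)) ≤
      1 / 8 * (2 * (unitVolume d * (δ * scale m) ^ d)) := by gcongr
  unfold scaleSum at h9 h10
  rw [mul_pow δ (scale m)] at *
  linarith

lemma nextFunction_support (he : ‖e‖ = 1) (hδ : 0 < δ) (hδ' : δ ≤ 1 / 16)
    (hf : ∀ y, f y ≠ 0 → ‖y‖ ≤ 2) {x : EuclideanSpace ℝ (Fin d)}
    (hx : nextFunction m e δ f x ≠ 0) : ‖x‖ ≤ 2 := by
  rcases ne_or_eq (coreIndicator d (δ * scale m) x) 0 with h | h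
  · have h1 := norm_lt_of_coreIndicator_ne_zero h
    have h2 := scale_le_one m
    have h3 := scale_pos m
    nlinarith
  · rw [nextFunction, h, zero_add] at hx
    obtain ⟨i, -, hi⟩ := Finset.exists_ne_zero_of_sum_ne_zero hx
    obtain ⟨y, hy, -, rfl⟩ := transport_ne_zero hf (mul_pos hδ (scale_pos i)) hi
    exact norm_child_le he hδ hδ' i hy

lemma ae_hasPrincipalValue_nextFunction {Ω : EuclideanSpace ℝ (Fin d) → ℝ}
    (hd : d ≠ 0) (hΩ : IsCZSymbol Ω) (hδ : 0 < δ)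
    (hf : ∀ᵐ x, ∃ l, HasPrincipalValue Ω f x l) :
    ∀ᵐ x, ∃ l, HasPrincipalValue Ω (nextFunction m e δ f) x l := by
  have : NeZero d := ⟨hd⟩
  have h1 : ∀ᵐ x, ∀ j : ℕ, ∃ l,
      HasPrincipalValue Ω (transport (scale j • e) (δ * scale j) f) x l := by
    refine ae_all_iff.2 fun j => ?_
    have hρ := mul_pos hδ (scale_pos j)
    filter_upwards [ae_transport hρ (scale j • e) hf] with x ⟨l, hl⟩
    have := hl.transport hd hΩ hρ (scale j • e)
    rw [affine_inverse hρ] at this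
    exact ⟨l, this⟩
  filter_upwards [h1, ae_hasPrincipalValue_ball hΩ 0 (δ * scale m)] with x hx ⟨l₀, hl₀⟩
  choose l hl using hx
  exact ⟨_, hl₀.add (HasPrincipalValue.sum _ fun j _ => hl j)⟩

/-- The square root of `scale j`. -/
def halfScale (j : ℕ) : ℝ := (1 / 2) ^ j

lemma halfScale_pos (j : ℕ) : 0 < halfScale j := by unfold halfScale; positivity

lemma halfScale_sq (j : ℕ) : halfScale j ^ 2 = scale j := by
  rw [halfScale, scale, ← pow_mul, mul_comm, pow_mul]
  norm_num

lemma sum_halfScale_pow_le (hd : d ≠ 0) (s : Finset ℕ) : ∑ j ∈ s, halfScale j ^ d ≤ 2 := by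
  have : ∀ j, halfScale j ^ d = ((1 / 2 : ℝ) ^ d) ^ j := fun j => by
    rw [halfScale, ← pow_mul, ← pow_mul, mul_comm]
  simp only [this]
  exact sum_geometric_le_two s (by positivity) (half_pow_le hd)

/-- The lower bound for the contribution of the core to the singular integral in a child cell. -/
def coreGain (d m : ℕ) (δ c : ℝ) (i : ℕ) : ℝ :=
  c / (2 * scale i) ^ d * (unitVolume d * (δ * scale m) ^ d)

/-- The upper bound for the contribution of the other child cells to the singular integral in a
child cell. -/
def siblingLoss (d m : ℕ) (δ B : ℝ) (i : ℕ) : ℝ :=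
  2 * (B * 2 ^ d * δ ^ d * (2 * (unitVolume d * (δ * scale m) ^ d))) * (halfScale i ^ d)⁻¹

variable {Ω : EuclideanSpace ℝ (Fin d) → ℝ}

/-- Seen from child `i`, the core lies almost in the direction `e`: the difference of the two points
is `scale i • (e + v)`, where `‖v‖ ≤ 3 * δ` collects `2 * δ` from the child and `δ` from the core.
There the kernel is positive and bounded below. -/
lemma coreGain_le_integral (hΩ : IsCZSymbol Ω) (he : ‖e‖ = 1) (hδ : 0 < δ)
    (hδ' : δ ≤ 1 / 16) {c : ℝ} (hc : 0 < c) (hlow : ∀ v, ‖v‖ ≤ 3 * δ → c ≤ Ω (e + v)) {i : ℕ}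
    (hi : i ∈ Finset.range m) {y : EuclideanSpace ℝ (Fin d)} (hy : ‖y‖ ≤ 2) :
    HasPrincipalValue Ω (coreIndicator d (δ * scale m)) (scale i • e + (δ * scale i) • y)
      (∫ z, czKernel Ω (scale i • e + (δ * scale i) • y) z * coreIndicator d (δ * scale m) z) ∧
    coreGain d m δ c i ≤
      ∫ z, czKernel Ω (scale i • e + (δ * scale i) • y) z * coreIndicator d (δ * scale m) z := by
  have hRi := scale_pos i
  have hη : 0 < δ * scale m := mul_pos hδ (scale_pos m)
  have hsep : ∀ z, coreIndicator d (δ * scale m) z ≠ 0 →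
      scale i / 2 ≤ ‖scale i • e + (δ * scale i) • y - z‖ := fun z hz => by
    rw [norm_sub_rev]
    exact core_separated he hδ hδ' (Finset.mem_range.1 hi) (norm_lt_of_coreIndicator_ne_zero hz) hy
  refine ⟨hasPrincipalValue_of_separated hΩ (integrable_coreIndicator _) (half_pos hRi) hsep, ?_⟩
  rw [coreGain, ← integral_coreIndicator hη, ← integral_const_mul]
  refine integral_mono ((integrable_coreIndicator _).const_mul _)
    (integrable_czKernel_mul_of_separated hΩ (integrable_coreIndicator _) (half_pos hRi) hsep)
    fun z => ?_
  by_cases hz : coreIndicator d (δ * scale m) z = 0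
  · simp [hz]
  refine mul_le_mul_of_nonneg_right ?_ (coreIndicator_nonneg _ z)
  have hz' := norm_lt_of_coreIndicator_ne_zero hz
  have hmi : scale m ≤ scale i := by
    have := scale_le_of_lt (Finset.mem_range.1 hi)
    linarith
  set v := δ • y - (scale i)⁻¹ • z with hv
  have hvn : ‖v‖ ≤ 3 * δ := by
    have h1 : ‖δ • y‖ ≤ 2 * δ := by
      rw [norm_smul, Real.norm_of_nonneg hδ.le]
      nlinarith
    have h2 : ‖(scale i)⁻¹ • z‖ ≤ δ := by
      rw [norm_smul, Real.norm_of_nonneg (inv_nonneg.2 hRi.le), inv_mul_le_iff₀ hRi]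
      nlinarith
    have := norm_sub_le (δ • y) ((scale i)⁻¹ • z)
    linarith
  have hxz : scale i • e + (δ * scale i) • y - z = scale i • (e + v) := by
    rw [hv, smul_add, smul_sub, smul_smul, smul_smul, mul_inv_cancel₀ hRi.ne', one_smul,
      mul_comm δ]
    abel
  have hne : e + v ≠ 0 := by
    intro h
    have : e = -v := eq_neg_of_add_eq_zero_left h
    rw [this, norm_neg] at he
    linarith
  have hnorm : ‖e + v‖ ≤ 2 := by
    have := norm_add_le e v
    linarith
  rw [czKernel, hxz, hΩ.homogeneous _ hRi _ hne, norm_smul, Real.norm_of_nonneg hRi.le]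
  have hpos : 0 < ‖e + v‖ := norm_pos_iff.2 hne
  have h1 := hlow v hvn
  have h2 : scale i * ‖e + v‖ ≤ 2 * scale i := by
    linarith [mul_le_mul_of_nonneg_left hnorm hRi.le]
  calc c / (2 * scale i) ^ d ≤ c / (scale i * ‖e + v‖) ^ d :=
        div_le_div_of_nonneg_left hc.le (by positivity) (pow_le_pow_left₀ (by positivity) h2 d)
    _ ≤ Ω (e + v) / (scale i * ‖e + v‖) ^ d := by gcongr

/-- The distance is at least half of both scales, hence at least half their geometric mean
`halfScale i * halfScale j`. This interpolation makes the bound a product of a factor in `i` and a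
factor in `j`, the latter summable uniformly in `m`. -/
lemma sibling_bound (hΩ : IsCZSymbol Ω) (he : ‖e‖ = 1) (hδ : 0 < δ)
    (hδ' : δ ≤ 1 / 16) {B : ℝ} (hB0 : 0 < B) (hB : ∀ x, x ≠ 0 → |Ω x| ≤ B)
    (hf : Integrable f) (hf0 : ∀ x, 0 ≤ f x) (hfs : ∀ y, f y ≠ 0 → ‖y‖ ≤ 2)
    (hfi : ∫ x, f x ≤ 2 * (unitVolume d * (δ * scale m) ^ d)) {i j : ℕ} (hij : i ≠ j)
    {y : EuclideanSpace ℝ (Fin d)} (hy : ‖y‖ ≤ 2) :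
    ∃ l, HasPrincipalValue Ω (transport (scale j • e) (δ * scale j) f)
        (scale i • e + (δ * scale i) • y) l ∧
      -(B * 2 ^ d * δ ^ d * (2 * (unitVolume d * (δ * scale m) ^ d)) * (halfScale i ^ d)⁻¹ *
        halfScale j ^ d) ≤ l := by
  have hi := halfScale_pos i
  have hj := halfScale_pos j
  have hρ := mul_pos hδ (scale_pos j)
  have hr : 0 < halfScale i * halfScale j / 2 := by positivity
  have hsep : ∀ z, transport (scale j • e) (δ * scale j) f z ≠ 0 →
      halfScale i * halfScale j / 2 ≤ ‖scale i • e + (δ * scale i) • y - z‖ := by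
    intro z hz
    obtain ⟨z, hz2, -, rfl⟩ := transport_ne_zero hfs hρ hz
    obtain ⟨h1, h2⟩ := child_separated he hδ hδ' hij hy hz2
    have h3 := halfScale_sq i
    have h4 := halfScale_sq j
    nlinarith [sq_nonneg (halfScale i - halfScale j)]
  refine ⟨_, hasPrincipalValue_of_separated hΩ (integrable_transport hρ _ hf) hr hsep, ?_⟩
  have h1 := abs_integral_czKernel_mul_le hB (integrable_transport hρ _ hf) (fun z => hf0 _) hr hsep
  rw [integral_transport hρ] at h1
  refine le_trans (neg_le_neg ?_) (neg_le_of_abs_le h1)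
  calc B / (halfScale i * halfScale j / 2) ^ d * ((δ * scale j) ^ d * ∫ x, f x)
      ≤ B / (halfScale i * halfScale j / 2) ^ d *
        ((δ * scale j) ^ d * (2 * (unitVolume d * (δ * scale m) ^ d))) := by gcongr
    _ = _ := by
      rw [← halfScale_sq j, div_pow, mul_pow, mul_pow δ (halfScale j ^ 2)]
      field_simp
      ring

/-- In a child cell, passing to the next generation increases the singular integral by at least
`coreGain - siblingLoss`. -/
lemma exists_hasPrincipalValue_nextFunction (hd : d ≠ 0) (hΩ : IsCZSymbol Ω) (he : ‖e‖ = 1)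
    (hδ : 0 < δ) (hδ' : δ ≤ 1 / 16) {c B : ℝ} (hc : 0 < c)
    (hlow : ∀ v, ‖v‖ ≤ 3 * δ → c ≤ Ω (e + v)) (hB0 : 0 < B) (hB : ∀ x, x ≠ 0 → |Ω x| ≤ B)
    (hf : Integrable f) (hf0 : ∀ x, 0 ≤ f x) (hfs : ∀ y, f y ≠ 0 → ‖y‖ ≤ 2)
    (hfi : ∫ x, f x ≤ 2 * (unitVolume d * (δ * scale m) ^ d)) {i : ℕ} (hi : i ∈ Finset.range m)
    {y : EuclideanSpace ℝ (Fin d)} (hy : ‖y‖ ≤ 2) {u : ℝ} (hu : HasPrincipalValue Ω f y u) :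
    ∃ u', HasPrincipalValue Ω (nextFunction m e δ f) (scale i • e + (δ * scale i) • y) u' ∧
      u + (coreGain d m δ c i - siblingLoss d m δ B i) ≤ u' := by
  set S := B * 2 ^ d * δ ^ d * (2 * (unitVolume d * (δ * scale m) ^ d)) * (halfScale i ^ d)⁻¹
    with hS
  have hS0 : 0 ≤ S := by
    have := unitVolume_pos d
    have := scale_pos m
    have := halfScale_pos i
    positivity
  obtain ⟨h1, h2⟩ := coreGain_le_integral hΩ he hδ hδ' hc hlow hi hy
  have h3 : ∀ j, ∃ l, HasPrincipalValue Ω (transport (scale j • e) (δ * scale j) f)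
      (scale i • e + (δ * scale i) • y) l ∧
      (if j = i then u else 0) - S * halfScale j ^ d ≤ l := by
    intro j
    have hj : 0 ≤ S * halfScale j ^ d := mul_nonneg hS0 (pow_nonneg (halfScale_pos j).le d)
    -- The copy in the child itself reproduces `u` exactly, by dilation invariance; only the others
    -- cost something.
    by_cases hji : j = i
    · subst hji
      refine ⟨u, hu.transport hd hΩ (mul_pos hδ (scale_pos j)) _, ?_⟩
      simpa using hj
    · obtain ⟨l, hl, hl'⟩ := sibling_bound hΩ he hδ hδ' hB0 hB hf hf0 hfs hfi (Ne.symm hji) hy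
      refine ⟨l, hl, ?_⟩
      rw [if_neg hji, zero_sub]
      exact hl'
  choose l hl hl' using h3
  refine ⟨_, h1.add (HasPrincipalValue.sum (Finset.range m) fun j _ => hl j), ?_⟩
  have h4 := Finset.sum_le_sum fun j (_ : j ∈ Finset.range m) => hl' j
  rw [Finset.sum_sub_distrib, Finset.sum_ite_eq' _ _ (fun _ => u), if_pos hi, ← Finset.mul_sum] at h4
  have h5 := mul_le_mul_of_nonneg_left (sum_halfScale_pow_le hd (Finset.range m)) hS0
  have h6 : siblingLoss d m δ B i = S * 2 := by rw [siblingLoss, hS]; ring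
  linarith

end NextFunction

/-! ### The induction over generations -/

section Configuration

variable {d : ℕ}

/-- The pair `(f, w)` of a function and a weight in the cell `{‖x‖ ≤ 2}`, with a bound `Φ` for an
exponential moment of `-T f` with respect to `w` and a bound `H` for `∫ |f| M w`. -/
structure IsConfiguration (Ω : EuclideanSpace ℝ (Fin d) → ℝ) (m : ℕ) (δ : ℝ) (Φ H : ℝ≥0∞)
    (f : EuclideanSpace ℝ (Fin d) → ℝ) (w : EuclideanSpace ℝ (Fin d) → ℝ≥0∞) : Prop where
  measurable_fun : Measurable f
  nonneg : ∀ x, 0 ≤ f x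
  support_fun : ∀ x, f x ≠ 0 → ‖x‖ ≤ 2
  integrable : Integrable f
  integral_le : ∫ x, f x ≤ 2 * (unitVolume d * (δ * scale m) ^ d)
  measurable_weight : Measurable w
  support_weight : ∀ x, w x ≠ 0 → ‖x‖ ≤ 2
  lintegral_weight : ∫⁻ x, w x = 1
  ae_hasPrincipalValue : ∀ᵐ x, ∃ l, HasPrincipalValue Ω f x l
  exp_moment : ∃ ψ : EuclideanSpace ℝ (Fin d) → ℝ≥0∞, Measurable ψ ∧
    (∀ x, w x ≠ 0 → ∃ u, HasPrincipalValue Ω f x u ∧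
      ENNReal.ofReal (Real.exp (-u)) * w x ≤ ψ x) ∧ ∫⁻ x, ψ x ≤ Φ
  maximal_bound : ∃ h : EuclideanSpace ℝ (Fin d) → ℝ≥0∞, Measurable h ∧
    (∀ x, ‖f x‖ₑ * (ENNReal.ofReal (coreConst d δ) ⊔ maximalFunction w x) ≤ h x) ∧
      ∫⁻ x, h x ≤ H

/-- The factor by which the exponential moment decreases. -/
def momentFactor (d m : ℕ) (δ c B : ℝ) : ℝ :=
  ∑ j ∈ Finset.range m, densityRatio d m δ * (δ * scale j) ^ d *
    Real.exp (-(coreGain d m δ c j - siblingLoss d m δ B j))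

/-- The increment of the bound for `∫ |f| M w`. -/
def maximalIncrement (d m : ℕ) (δ : ℝ) : ℝ :=
  densityRatio d m δ * coreConst d δ * (unitVolume d * (δ * scale m) ^ d)

variable {m : ℕ} {e : EuclideanSpace ℝ (Fin d)} {δ : ℝ} {f : EuclideanSpace ℝ (Fin d) → ℝ}
  {w : EuclideanSpace ℝ (Fin d) → ℝ≥0∞} {Ω : EuclideanSpace ℝ (Fin d) → ℝ} {Φ H : ℝ≥0∞}

lemma exists_isConfiguration_zero (hδ : 0 < δ) :
    ∃ w, IsConfiguration Ω m δ 1 0 (fun _ : EuclideanSpace ℝ (Fin d) => 0) w := by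
  set b := Metric.ball (0 : EuclideanSpace ℝ (Fin d)) 1
  have hw : Measurable (b.indicator fun _ => (volume b)⁻¹) :=
    measurable_const.indicator measurableSet_ball
  have hw1 : ∫⁻ x, b.indicator (fun _ => (volume b)⁻¹) x = 1 := by
    rw [lintegral_indicator measurableSet_ball, setLIntegral_const]
    exact ENNReal.inv_mul_cancel (Metric.measure_ball_pos _ _ one_pos).ne' measure_ball_lt_top.ne
  refine ⟨b.indicator fun _ => (volume b)⁻¹, measurable_const, fun _ => le_rfl, by simp, by simp,
    ?_, hw, fun x hx => ?_, hw1, ae_of_all _ fun x => ⟨0, hasPrincipalValue_zero⟩,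
    ⟨_, hw, fun x _ => ⟨0, hasPrincipalValue_zero, by simp⟩, hw1.le⟩,
    ⟨fun _ => 0, measurable_const, by simp, by simp⟩⟩
  · have := unitVolume_pos d
    have := scale_pos m
    simp only [integral_zero]
    positivity
  · have : ‖x‖ < 1 := by simpa [b] using Set.mem_of_indicator_ne_zero hx
    linarith

/-- In child `j` the factor `exp (-u)` shrinks by the net gain there, and the child carries the
share `densityRatio d m δ * (δ * scale j) ^ d` of the mass; `momentFactor` is the resulting average.
Working with a measurable majorant `ψ` avoids the measurability of `T f`. -/
lemma IsConfiguration.next_exp_moment (h : IsConfiguration Ω m δ Φ H f w) (hd : d ≠ 0)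
    (hm : m ≠ 0) (hΩ : IsCZSymbol Ω) (he : ‖e‖ = 1) (hδ : 0 < δ) (hδ' : δ ≤ 1 / 16) {c B : ℝ}
    (hc : 0 < c) (hlow : ∀ v, ‖v‖ ≤ 3 * δ → c ≤ Ω (e + v)) (hB0 : 0 < B)
    (hB : ∀ x, x ≠ 0 → |Ω x| ≤ B) :
    ∃ ψ : EuclideanSpace ℝ (Fin d) → ℝ≥0∞, Measurable ψ ∧
      (∀ x, nextWeight m e δ w x ≠ 0 → ∃ u, HasPrincipalValue Ω (nextFunction m e δ f) x u ∧
        ENNReal.ofReal (Real.exp (-u)) * nextWeight m e δ w x ≤ ψ x) ∧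
      ∫⁻ x, ψ x ≤ ENNReal.ofReal (momentFactor d m δ c B) * Φ := by
  obtain ⟨ψ, hψ, hψw, hψΦ⟩ := h.exp_moment
  have hκ := densityRatio_pos d hm hδ
  set z : ℕ → ℝ := fun j => coreGain d m δ c j - siblingLoss d m δ B j with hz
  have hmeas : ∀ j, Measurable fun x => ENNReal.ofReal (densityRatio d m δ * Real.exp (-z j)) *
      transport (scale j • e) (δ * scale j) ψ x := fun j =>
    (measurable_transport _ _ hψ).const_mul _
  refine ⟨fun x => ∑ j ∈ Finset.range m, ENNReal.ofReal (densityRatio d m δ * Real.exp (-z j)) *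
    transport (scale j • e) (δ * scale j) ψ x, Finset.measurable_fun_sum _ fun j _ => hmeas j, ?_, ?_⟩
  · intro x hx
    obtain ⟨i, hi, y, hy, hwy, rfl⟩ := nextWeight_ne_zero hδ h.support_weight hx
    obtain ⟨u, hu, huψ⟩ := hψw y hwy
    obtain ⟨u', hu', huu'⟩ := exists_hasPrincipalValue_nextFunction hd hΩ he hδ hδ' hc hlow hB0 hB
      h.integrable h.nonneg h.support_fun h.integral_le hi hy hu
    refine ⟨u', hu', ?_⟩
    rw [nextWeight_child he hδ hδ' h.support_weight hi hy]
    calc ENNReal.ofReal (Real.exp (-u')) * (ENNReal.ofReal (densityRatio d m δ) * w y)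
        ≤ ENNReal.ofReal (Real.exp (-z i) * Real.exp (-u)) *
          (ENNReal.ofReal (densityRatio d m δ) * w y) := by
          gcongr
          rw [← Real.exp_add]
          refine Real.exp_le_exp.2 ?_
          simp only [hz]
          linarith
      _ = ENNReal.ofReal (densityRatio d m δ * Real.exp (-z i)) *
          (ENNReal.ofReal (Real.exp (-u)) * w y) := by
          rw [ENNReal.ofReal_mul (Real.exp_pos _).le, ENNReal.ofReal_mul hκ.le]
          ring
      _ ≤ ENNReal.ofReal (densityRatio d m δ * Real.exp (-z i)) *
          transport (scale i • e) (δ * scale i) ψ (scale i • e + (δ * scale i) • y) := by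
          rw [transport_apply_affine (mul_pos hδ (scale_pos i))]
          gcongr
      _ ≤ _ := Finset.single_le_sum (f := fun j =>
          ENNReal.ofReal (densityRatio d m δ * Real.exp (-z j)) *
            transport (scale j • e) (δ * scale j) ψ (scale i • e + (δ * scale i) • y))
          (fun _ _ => zero_le) hi
  · rw [lintegral_finsetSum _ fun j _ => hmeas j, momentFactor, ENNReal.ofReal_sum_of_nonneg,
      Finset.sum_mul]
    · refine Finset.sum_le_sum fun j _ => ?_
      have hρ := mul_pos hδ (scale_pos j)
      rw [lintegral_const_mul _ (measurable_transport _ _ hψ), lintegral_transport hρ, ← mul_assoc,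
        ← ENNReal.ofReal_mul (by positivity), mul_right_comm]
      gcongr
    · intro j _
      have := scale_pos j
      positivity

/-- The floor `coreConst d δ` under the maximal function lets the induction close:
`maximalFunction_nextWeight_child_le` produces it, and it survives multiplication by the density
factor, which is at least one. -/
lemma IsConfiguration.next_maximal_bound (h : IsConfiguration Ω m δ Φ H f w) (hd : d ≠ 0)
    (hm : m ≠ 0) (he : ‖e‖ = 1) (hδ : 0 < δ) (hδ' : δ ≤ 1 / 16) :
    ∃ g : EuclideanSpace ℝ (Fin d) → ℝ≥0∞, Measurable g ∧
      (∀ x, ‖nextFunction m e δ f x‖ₑ *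
        (ENNReal.ofReal (coreConst d δ) ⊔ maximalFunction (nextWeight m e δ w) x) ≤ g x) ∧
      ∫⁻ x, g x ≤ ENNReal.ofReal (maximalIncrement d m δ) + H := by
  obtain ⟨g, hg, hgf, hgH⟩ := h.maximal_bound
  have hκ := densityRatio_pos d hm hδ
  have hκ1 : 1 ≤ ENNReal.ofReal (densityRatio d m δ) :=
    ENNReal.one_le_ofReal.2 (one_le_densityRatio hd hm hδ hδ')
  have hη : 0 < δ * scale m := mul_pos hδ (scale_pos m)
  set core : EuclideanSpace ℝ (Fin d) → ℝ≥0∞ := (Metric.ball 0 (δ * scale m)).indicator fun _ =>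
    ENNReal.ofReal (densityRatio d m δ) * ENNReal.ofReal (coreConst d δ) with hcore
  have hcm : Measurable core := measurable_const.indicator measurableSet_ball
  refine ⟨fun x => core x + nextWeight m e δ g x, hcm.add (measurable_nextWeight hg), ?_, ?_⟩
  · intro x
    have h1 : ‖nextFunction m e δ f x‖ₑ ≤ ‖coreIndicator d (δ * scale m) x‖ₑ +
        ∑ j ∈ Finset.range m, ‖transport (scale j • e) (δ * scale j) f x‖ₑ :=
      (enorm_add_le _ _).trans (add_le_add_right (enorm_sum_le _ _) _)
    refine (mul_le_mul_left h1 _).trans ?_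
    have h2 : nextWeight m e δ g x = ∑ j ∈ Finset.range m, ENNReal.ofReal (densityRatio d m δ) *
        transport (scale j • e) (δ * scale j) g x := Finset.mul_sum _ _ _
    beta_reduce
    rw [add_mul, Finset.sum_mul, h2]
    refine add_le_add ?_ (Finset.sum_le_sum fun i hi => ?_)
    · by_cases hx : coreIndicator d (δ * scale m) x = 0
      · simp [hx]
      · have hx' := norm_lt_of_coreIndicator_ne_zero hx
        have hxb : x ∈ Metric.ball (0 : EuclideanSpace ℝ (Fin d)) (δ * scale m) := by simpa using hx'
        rw [hcore, coreIndicator, Set.indicator_of_mem hxb, Set.indicator_of_mem hxb, enorm_one,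
          one_mul]
        exact sup_le (le_mul_of_one_le_left zero_le hκ1)
          (maximalFunction_nextWeight_core_le hd he hδ hδ' h.measurable_weight h.support_weight
            h.lintegral_weight hx')
    · by_cases hx : transport (scale i • e) (δ * scale i) f x = 0
      · simp [hx]
      · have hρ := mul_pos hδ (scale_pos i)
        obtain ⟨y, hy, -, rfl⟩ := transport_ne_zero h.support_fun hρ hx
        rw [transport_apply_affine hρ, transport_apply_affine hρ]
        calc _ ≤ ‖f y‖ₑ * (ENNReal.ofReal (densityRatio d m δ) *
              (ENNReal.ofReal (coreConst d δ) ⊔ maximalFunction w y)) := by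
              refine mul_le_mul_right (sup_le ?_ ?_) _
              · exact le_sup_left.trans (le_mul_of_one_le_left zero_le hκ1)
              · exact maximalFunction_nextWeight_child_le hd he hδ hδ' h.measurable_weight
                  h.support_weight h.lintegral_weight hi hy
          _ ≤ _ := by
              rw [mul_left_comm]
              exact mul_le_mul_right (hgf y) _
  -- The child part is `nextWeight` applied to the old majorant, so its integral is unchanged; the
  -- increment comes from the core alone.
  · rw [lintegral_add_left hcm, lintegral_nextWeight hm hδ hg, hcore,
      lintegral_indicator measurableSet_ball, setLIntegral_const, volume_ball_zero hη,
      ← ENNReal.ofReal_mul hκ.le,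
      ← ENNReal.ofReal_mul (mul_nonneg hκ.le (coreConst_nonneg d hδ)), maximalIncrement]
    gcongr

lemma IsConfiguration.next (h : IsConfiguration Ω m δ Φ H f w) (hd : d ≠ 0)
    (hm : m ≠ 0) (hΩ : IsCZSymbol Ω) (he : ‖e‖ = 1) (hδ : 0 < δ) (hδ' : δ ≤ 1 / 16) {c B : ℝ}
    (hc : 0 < c) (hlow : ∀ v, ‖v‖ ≤ 3 * δ → c ≤ Ω (e + v)) (hB0 : 0 < B)
    (hB : ∀ x, x ≠ 0 → |Ω x| ≤ B) :
    IsConfiguration Ω m δ (ENNReal.ofReal (momentFactor d m δ c B) * Φ)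
      (ENNReal.ofReal (maximalIncrement d m δ) + H) (nextFunction m e δ f)
      (nextWeight m e δ w) where
  measurable_fun := measurable_nextFunction h.measurable_fun
  nonneg := nextFunction_nonneg h.nonneg
  support_fun _ := nextFunction_support he hδ hδ' h.support_fun
  integrable := integrable_nextFunction hδ h.integrable
  integral_le := integral_nextFunction_le hd hδ hδ' h.integrable h.integral_le
  measurable_weight := measurable_nextWeight h.measurable_weight
  support_weight x hx := by
    obtain ⟨i, -, y, hy, -, rfl⟩ := nextWeight_ne_zero hδ h.support_weight hx
    exact norm_child_le he hδ hδ' i hy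
  lintegral_weight := by rw [lintegral_nextWeight hm hδ h.measurable_weight, h.lintegral_weight]
  ae_hasPrincipalValue := ae_hasPrincipalValue_nextFunction hd hΩ hδ h.ae_hasPrincipalValue
  exp_moment := h.next_exp_moment hd hm hΩ he hδ hδ' hc hlow hB0 hB
  maximal_bound := h.next_maximal_bound hd hm he hδ hδ'

/-- The last clause records that `f` is nontrivial after one step, which makes its weighted norm
positive. -/
lemma exists_isConfiguration (hd : d ≠ 0)
    (hm : m ≠ 0) (hΩ : IsCZSymbol Ω) (he : ‖e‖ = 1) (hδ : 0 < δ) (hδ' : δ ≤ 1 / 16) {c B : ℝ}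
    (hc : 0 < c) (hlow : ∀ v, ‖v‖ ≤ 3 * δ → c ≤ Ω (e + v)) (hB0 : 0 < B)
    (hB : ∀ x, x ≠ 0 → |Ω x| ≤ B) (n : ℕ) :
    ∃ f w, IsConfiguration Ω m δ (ENNReal.ofReal (momentFactor d m δ c B) ^ n)
      (n * ENNReal.ofReal (maximalIncrement d m δ)) f w ∧
      (n ≠ 0 → ∀ x, coreIndicator d (δ * scale m) x ≤ f x) := by
  induction n with
  | zero =>
    obtain ⟨w, hw⟩ := exists_isConfiguration_zero (Ω := Ω) (m := m) hδ
    exact ⟨_, w, by simpa using hw, by simp⟩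
  | succ n ih =>
    obtain ⟨f, w, h, -⟩ := ih
    have := h.next hd hm hΩ he hδ hδ' hc hlow hB0 hB
    refine ⟨nextFunction m e δ f, nextWeight m e δ w, ?_, fun _ => coreIndicator_le_nextFunction h.nonneg⟩
    · convert this using 1
      · rw [pow_succ']
      · push_cast
        ring

end Configuration

/-! ### Estimate of the moment factor and choice of `m`, `n`, `t` -/

section Parameters

/-- Linearisation of the exponential, so that gains and losses can be averaged over the children; it
follows from `1 + x ≤ exp x` at `G` and at `-L`. -/
lemma exp_neg_sub_le {G L : ℝ} (hG0 : 0 ≤ G) (hG1 : G ≤ 1) (hL0 : 0 ≤ L) (hL1 : L ≤ 1 / 2) :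
    Real.exp (-(G - L)) ≤ 1 - G / 2 + 2 * L := by
  have h1 : Real.exp (-G) ≤ 1 - G / 2 := by
    rw [Real.exp_neg, inv_le_iff_one_le_mul₀ (Real.exp_pos _)]
    have := Real.add_one_le_exp G
    nlinarith
  have h2 : Real.exp L ≤ 1 + 2 * L := by
    rw [← neg_neg L, Real.exp_neg, inv_le_iff_one_le_mul₀ (Real.exp_pos _), neg_neg]
    have := Real.add_one_le_exp (-L)
    nlinarith
  have h3 : -(G - L) = -G + L := by ring
  rw [h3, Real.exp_add]
  have := mul_le_mul h1 h2 (Real.exp_pos _).le (by linarith)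
  nlinarith

variable {d m : ℕ} {δ c B : ℝ}

lemma densityRatio_mul_pow (hδ : 0 < δ) : densityRatio d m δ * δ ^ d = (scaleSum d m)⁻¹ := by
  rw [densityRatio, mul_inv]
  field_simp

lemma halfScale_le_of_lt {i j : ℕ} (h : i < j) : halfScale j ≤ halfScale i :=
  pow_le_pow_of_le_one (by norm_num) (by norm_num) h.le

lemma halfScale_le_one (j : ℕ) : halfScale j ≤ 1 := pow_le_one₀ (by norm_num) (by norm_num)

lemma coreGain_eq (i : ℕ) : coreGain d m δ c i =
    c * unitVolume d / 2 ^ d * (δ * scale m) ^ d * (scale i ^ d)⁻¹ := by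
  rw [coreGain, mul_pow 2 (scale i)]
  have := scale_pos i
  field_simp

lemma siblingLoss_eq (i : ℕ) : siblingLoss d m δ B i =
    4 * B * 2 ^ d * δ ^ d * unitVolume d * (δ * scale m) ^ d * (halfScale i ^ d)⁻¹ := by
  rw [siblingLoss]
  ring

lemma coreGain_le_one (hδ : 0 < δ) (hδ' : δ ≤ 1 / 16)
    (hc' : c * unitVolume d ≤ 2 ^ d) {i : ℕ} (hi : i < m) : coreGain d m δ c i ≤ 1 := by
  have h1 := scale_pos i
  have h2 := scale_pos m
  have h3 := scale_le_of_lt hi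
  have h4 := unitVolume_pos d
  have h5 : c * unitVolume d / 2 ^ d ≤ 1 := (div_le_one (by positivity)).2 hc'
  have h6 : (δ * scale m) ^ d ≤ scale i ^ d := pow_le_pow_left₀ (by positivity) (by nlinarith) d
  rw [coreGain_eq, ← div_eq_mul_inv, div_le_one (by positivity)]
  calc _ ≤ 1 * scale i ^ d := by gcongr
    _ = _ := one_mul _

/-- Since `δ * scale m ≤ halfScale m ^ 2`, one factor `halfScale m ^ d` absorbs the singular factor
of child `i`, and the other is small for large `m`. -/
lemma siblingLoss_le_half (hd : d ≠ 0) (hδ : 0 < δ) (hδ' : δ ≤ 1 / 16) (hB : 0 < B)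
    (hm : 4 * B * 2 ^ d * δ ^ d * unitVolume d * halfScale m ≤ 1 / 2) {i : ℕ} (hi : i < m) :
    siblingLoss d m δ B i ≤ 1 / 2 := by
  have h1 := halfScale_pos i
  have h2 := halfScale_pos m
  have h4 := unitVolume_pos d
  have h5 : (δ * scale m) ^ d ≤ halfScale m * halfScale i ^ d := by
    calc (δ * scale m) ^ d ≤ (halfScale m * halfScale m) ^ d := by
          refine pow_le_pow_left₀ (mul_pos hδ (scale_pos m)).le ?_ d
          rw [← halfScale_sq]
          nlinarith
      _ = halfScale m ^ d * halfScale m ^ d := mul_pow _ _ _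
      _ ≤ halfScale m * halfScale i ^ d := by
          have h6 := pow_le_of_le_one h2.le (halfScale_le_one m) hd
          have h7 := halfScale_le_of_lt hi
          gcongr
  rw [siblingLoss_eq, ← div_eq_mul_inv, div_le_iff₀ (by positivity)]
  calc _ ≤ 4 * B * 2 ^ d * δ ^ d * unitVolume d * (halfScale m * halfScale i ^ d) := by gcongr
    _ = 4 * B * 2 ^ d * δ ^ d * unitVolume d * halfScale m * halfScale i ^ d := by ring
    _ ≤ _ := by gcongr

/-- The net gain per unit of volume of the cores. -/
def netGain (d m : ℕ) (δ c B : ℝ) : ℝ :=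
  m * (c * unitVolume d / 2 ^ d) / 2 - 4 * (4 * B * 2 ^ d * δ ^ d * unitVolume d)

lemma momentFactor_le (hd : d ≠ 0) (hm : m ≠ 0) (hδ : 0 < δ) (hδ' : δ ≤ 1 / 16) (hc : 0 < c)
    (hc' : c * unitVolume d ≤ 2 ^ d) (hB : 0 < B)
    (hmB : 4 * B * 2 ^ d * δ ^ d * unitVolume d * halfScale m ≤ 1 / 2)
    (hD : 0 ≤ netGain d m δ c B) :
    momentFactor d m δ c B ≤ 1 - (δ * scale m) ^ d * netGain d m δ c B / 2 := by
  have hV := unitVolume_pos d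
  have hη : 0 < (δ * scale m) ^ d := pow_pos (mul_pos hδ (scale_pos m)) d
  have hκ := densityRatio_pos d hm hδ
  have hP1 := one_le_scaleSum d hm
  have hP2 := scaleSum_le_two hd m
  set h := (δ * scale m) ^ d with hh
  set a := c * unitVolume d / 2 ^ d with ha
  set b := 4 * B * 2 ^ d * δ ^ d * unitVolume d with hb
  have hb0 : 0 ≤ b := by positivity
  -- Multiplying by the mass of the child cancels `(scale j ^ d)⁻¹` in the gain, leaving the same
  -- amount for each `j`, and turns `(halfScale j ^ d)⁻¹` in the loss into the summable `halfScale j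
  -- ^ d`.
  have hterm : ∀ j ∈ Finset.range m, densityRatio d m δ * (δ * scale j) ^ d *
      Real.exp (-(coreGain d m δ c j - siblingLoss d m δ B j)) ≤
      densityRatio d m δ * (δ * scale j) ^ d - (scaleSum d m)⁻¹ * (a * h / 2) +
        (scaleSum d m)⁻¹ * (2 * b * h) * halfScale j ^ d := by
    intro j hj
    have hj' := Finset.mem_range.1 hj
    have hRj := scale_pos j
    have htj := halfScale_pos j
    have h1 := exp_neg_sub_le (G := coreGain d m δ c j) (L := siblingLoss d m δ B j)
      (by rw [coreGain_eq]; positivity) (coreGain_le_one hδ hδ' hc' hj')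
      (by rw [siblingLoss_eq]; positivity) (siblingLoss_le_half hd hδ hδ' hB hmB hj')
    refine (mul_le_mul_of_nonneg_left h1 (by positivity)).trans (le_of_eq ?_)
    rw [coreGain_eq, siblingLoss_eq, ← ha, ← hb, ← hh, ← densityRatio_mul_pow hδ,
      mul_pow δ (scale j), ← halfScale_sq j]
    field_simp
    ring
  refine (Finset.sum_le_sum hterm).trans ?_
  rw [Finset.sum_add_distrib, Finset.sum_sub_distrib, ← Finset.mul_sum,
    densityRatio_mul_sum d hm hδ, ← Finset.mul_sum, Finset.sum_const, Finset.card_range,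
    nsmul_eq_mul, ← Finset.mul_sum]
  have h2 := sum_halfScale_pow_le hd (Finset.range m)
  have h3 : (scaleSum d m)⁻¹ * (2 * b * h) * ∑ j ∈ Finset.range m, halfScale j ^ d ≤
      (scaleSum d m)⁻¹ * (2 * b * h) * 2 := by gcongr
  have h4 : (2 : ℝ)⁻¹ ≤ (scaleSum d m)⁻¹ := inv_anti₀ (by linarith) hP2
  have h5 : netGain d m δ c B = m * a / 2 - 4 * b := rfl
  have h6 : 0 ≤ h * netGain d m δ c B := by positivity
  have h7 := mul_le_mul_of_nonneg_right h4 h6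
  rw [h5] at *
  nlinarith

lemma momentFactor_nonneg (hm : m ≠ 0) (hδ : 0 < δ) : 0 ≤ momentFactor d m δ c B := by
  have := densityRatio_pos d hm hδ
  refine Finset.sum_nonneg fun j _ => ?_
  have := scale_pos j
  positivity

lemma densityRatio_le (hm : m ≠ 0) (hδ : 0 < δ) : densityRatio d m δ ≤ (δ ^ d)⁻¹ := by
  have := one_le_scaleSum d hm
  have : 0 < δ ^ d := by positivity
  refine inv_anti₀ this ?_
  nlinarith

/-- There are arbitrarily deep cells for which the net gain is large, while the bound for the
maximal function remains under control. -/
lemma exists_parameters (hd : d ≠ 0) (hδ : 0 < δ) (hδ' : δ ≤ 1 / 16) (hc : 0 < c)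
    (hc' : c * unitVolume d ≤ 2 ^ d) (hB : 0 < B) {N : ℝ} (hN : 0 < N) :
    ∃ m n : ℕ, ∃ t : ℝ, m ≠ 0 ∧ n ≠ 0 ∧ 0 < t ∧
      N / t * (n * maximalIncrement d m δ) ≤ 1 / 2 ∧
      Real.exp t * momentFactor d m δ c B ^ n ≤ 1 / 2 := by
  have hV := unitVolume_pos d
  -- A bound for the total cost that does not depend on `m`, so `m` can be chosen after it.
  set K := 2 * (coreConst d δ * unitVolume d * (δ ^ d)⁻¹) with hK
  have hK0 : 0 ≤ K := by
    have := coreConst_nonneg d hδ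
    positivity
  have hlim1 : Tendsto (fun m : ℕ => netGain d m δ c B) atTop atTop := by
    refine tendsto_atTop_add_const_right _ _ ?_
    refine Tendsto.atTop_div_const two_pos ?_
    exact tendsto_natCast_atTop_atTop.atTop_mul_const (by positivity)
  have hlim2 : Tendsto (fun m : ℕ => 4 * B * 2 ^ d * δ ^ d * unitVolume d * halfScale m) atTop
      (𝓝 0) := by
    have := (tendsto_pow_atTop_nhds_zero_of_lt_one (r := (1 / 2 : ℝ)) (by norm_num)
      (by norm_num)).const_mul (4 * B * 2 ^ d * δ ^ d * unitVolume d)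
    rwa [mul_zero] at this
  obtain ⟨m, hm1, hm2, hm3⟩ := ((hlim1.eventually_ge_atTop (4 * max 1 (2 * N * K))).and
    ((hlim2.eventually_le_const (by norm_num : (0 : ℝ) < 1 / 2)).and (eventually_ne_atTop 0))).exists
  set D := netGain d m δ c B with hD
  have hD1 : 1 ≤ D / 4 := by linarith [le_max_left 1 (2 * N * K)]
  have hD2 : 2 * N * K ≤ D / 4 := by linarith [le_max_right 1 (2 * N * K)]
  set h := (δ * scale m) ^ d with hh
  have hη : 0 < h := pow_pos (mul_pos hδ (scale_pos m)) d
  have hη1 : h ≤ 1 := by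
    refine pow_le_one₀ (mul_pos hδ (scale_pos m)).le ?_
    nlinarith [scale_pos m, scale_le_one m]
  have hn1 : 1 ≤ (⌈h⁻¹⌉₊ : ℝ) * h := by
    have := Nat.le_ceil h⁻¹
    calc 1 = h⁻¹ * h := (inv_mul_cancel₀ hη.ne').symm
      _ ≤ _ := by gcongr
  have hn2 : (⌈h⁻¹⌉₊ : ℝ) * h ≤ 2 := by
    have := (Nat.ceil_lt_add_one (inv_nonneg.2 hη.le)).le
    calc _ ≤ (h⁻¹ + 1) * h := by gcongr
      _ = 1 + h := by rw [add_mul, inv_mul_cancel₀ hη.ne', one_mul]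
      _ ≤ 2 := by linarith
  -- With `1 ≤ n * h ≤ 2`, the moment is at most `exp (-D / 2)` and the cost at most `K`. The level
  -- `t = D / 4` leaves `exp (-D / 4) ≤ 1 / 2` for Chebyshev's inequality.
  refine ⟨m, ⌈h⁻¹⌉₊, D / 4, hm3, (Nat.ceil_pos.2 (inv_pos.2 hη)).ne', by linarith, ?_, ?_⟩
  · have h1 : (⌈h⁻¹⌉₊ : ℝ) * maximalIncrement d m δ ≤ K := by
      have h2 := densityRatio_le (d := d) hm3 hδ
      have h3 := densityRatio_pos d hm3 hδ
      have h4 := coreConst_nonneg d hδ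
      calc (⌈h⁻¹⌉₊ : ℝ) * maximalIncrement d m δ =
          densityRatio d m δ * (coreConst d δ * unitVolume d) * (⌈h⁻¹⌉₊ * h) := by
            rw [maximalIncrement]; ring
        _ ≤ (δ ^ d)⁻¹ * (coreConst d δ * unitVolume d) * 2 := by gcongr
        _ = K := by rw [hK]; ring
    calc N / (D / 4) * (⌈h⁻¹⌉₊ * maximalIncrement d m δ) ≤ N / (D / 4) * K := by gcongr
      _ ≤ 1 / 2 := by
          rw [div_mul_eq_mul_div, div_le_iff₀ (by linarith)]
          linarith
  · have h1 := momentFactor_le hd hm3 hδ hδ' hc hc' hB hm2 (by linarith)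
    rw [← hD, ← hh] at h1
    have h2 : momentFactor d m δ c B ≤ Real.exp (-(h * D / 2)) := by
      have := Real.add_one_le_exp (-(h * D / 2))
      linarith
    have h3 : momentFactor d m δ c B ^ ⌈h⁻¹⌉₊ ≤ Real.exp (-(D / 2)) := by
      refine (pow_le_pow_left₀ (momentFactor_nonneg hm3 hδ) h2 _).trans ?_
      rw [← Real.exp_nat_mul, Real.exp_le_exp]
      nlinarith
    calc Real.exp (D / 4) * momentFactor d m δ c B ^ ⌈h⁻¹⌉₊
        ≤ Real.exp (D / 4) * Real.exp (-(D / 2)) := by gcongr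
      _ = (Real.exp (D / 4))⁻¹ := by
          rw [← Real.exp_add, ← Real.exp_neg]
          congr 1
          ring
      _ ≤ 1 / 2 := by
          rw [one_div]
          refine inv_anti₀ two_pos ?_
          linarith [Real.add_one_le_exp (D / 4)]

end Parameters

/-! ### Chebyshev's inequality and the conclusion -/

section Counterexample

variable {d m : ℕ} {δ : ℝ} {f : EuclideanSpace ℝ (Fin d) → ℝ}
  {w : EuclideanSpace ℝ (Fin d) → ℝ≥0∞} {Ω : EuclideanSpace ℝ (Fin d) → ℝ} {Φ H : ℝ≥0∞}

/-- A single cube of side `4` contains the cell and hence the whole mass of `w`. Thus `M w` does not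
vanish where `f` lives. -/
lemma IsConfiguration.inv_le_maximalFunction (h : IsConfiguration Ω m δ Φ H f w)
    {x : EuclideanSpace ℝ (Fin d)} (hx : ‖x‖ ≤ 2) :
    (ENNReal.ofReal ((2 * 2) ^ d))⁻¹ ≤ maximalFunction w x := by
  have := le_maximalFunction_of_mem_closedBall two_pos h.support_weight hx
  rwa [h.lintegral_weight, one_div] at this

lemma IsConfiguration.weightedNorm_le (h : IsConfiguration Ω m δ Φ H f w) :
    weightedNorm f (maximalFunction w) ≤ H := by
  obtain ⟨g, -, hg, hgH⟩ := h.maximal_bound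
  exact (lintegral_mono fun x => (mul_le_mul_right le_sup_right _).trans (hg x)).trans hgH

lemma IsConfiguration.memWeightedL1 (h : IsConfiguration Ω m δ Φ H f w) (hH : H < ∞) :
    MemWeightedL1 f (maximalFunction w) := by
  refine ⟨h.measurable_fun.aestronglyMeasurable, ae_of_all _ fun x hx => ?_,
    h.weightedNorm_le.trans_lt hH⟩
  by_contra hne
  have := h.inv_le_maximalFunction (h.support_fun x hne)
  rw [hx, nonpos_iff_eq_zero, ENNReal.inv_eq_zero] at this
  exact ENNReal.ofReal_ne_top this

lemma IsConfiguration.weightedNorm_pos (h : IsConfiguration Ω m δ Φ H f w) (hδ : 0 < δ)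
    (hδ' : δ ≤ 1 / 16) (hf : ∀ x, coreIndicator d (δ * scale m) x ≤ f x) :
    0 < weightedNorm f (maximalFunction w) := by
  have hη : 0 < δ * scale m := mul_pos hδ (scale_pos m)
  set b := Metric.ball (0 : EuclideanSpace ℝ (Fin d)) (δ * scale m) with hb
  have h1 : ∫⁻ x, b.indicator (fun _ => (ENNReal.ofReal ((2 * 2) ^ d))⁻¹) x ≤
      weightedNorm f (maximalFunction w) := by
    refine lintegral_mono fun x => ?_
    by_cases hx : x ∈ b
    · rw [Set.indicator_of_mem hx]
      have h2 : ‖x‖ < δ * scale m := by simpa [hb] using hx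
      have h3 := hf x
      rw [coreIndicator, Set.indicator_of_mem hx] at h3
      have h4 : 1 ≤ ‖f x‖ₑ := by
        rw [Real.enorm_of_nonneg (h.nonneg x)]
        exact ENNReal.one_le_ofReal.2 h3
      refine (h.inv_le_maximalFunction (x := x) ?_).trans (le_mul_of_one_le_left zero_le h4)
      nlinarith [scale_le_one m, scale_pos m]
    · rw [Set.indicator_of_notMem hx]
      exact zero_le
  refine lt_of_lt_of_le ?_ h1
  rw [lintegral_indicator measurableSet_ball, setLIntegral_const]
  exact ENNReal.mul_pos (ENNReal.inv_ne_zero.2 ENNReal.ofReal_ne_top)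
    (Metric.measure_ball_pos _ _ hη).ne'

/-- Chebyshev's inequality for the exponential moment: most of the weight lives where the
principal value exceeds `t`. -/
lemma IsConfiguration.half_le_weightOf (h : IsConfiguration Ω m δ Φ H f w) {t : ℝ}
    (ht : ENNReal.ofReal (Real.exp t) * Φ ≤ 1 / 2) {E : Set (EuclideanSpace ℝ (Fin d))}
    (hE : ∀ x u, HasPrincipalValue Ω f x u → t < |u| → x ∈ E) : 1 / 2 ≤ weightOf w E := by
  obtain ⟨ψ, hψ, hψw, hψΦ⟩ := h.exp_moment
  -- `E` need not be measurable; `F` is a measurable set containing its complement.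
  set F := {x | w x ≤ ENNReal.ofReal (Real.exp t) * ψ x} with hF
  have hFm : MeasurableSet F := measurableSet_le h.measurable_weight (hψ.const_mul _)
  have h1 : Eᶜ ⊆ F := by
    intro x hx
    by_cases hwx : w x = 0
    · simp [hF, hwx]
    obtain ⟨u, hu, huψ⟩ := hψw x hwx
    have hut : u ≤ t := (le_abs_self u).trans (not_lt.1 fun h' => hx (hE x u hu h'))
    calc w x = ENNReal.ofReal (Real.exp u) * (ENNReal.ofReal (Real.exp (-u)) * w x) := by
          rw [← mul_assoc, ← ENNReal.ofReal_mul (Real.exp_pos _).le, ← Real.exp_add,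
            add_neg_cancel, Real.exp_zero, ENNReal.ofReal_one, one_mul]
      _ ≤ ENNReal.ofReal (Real.exp t) * ψ x := by gcongr
  have h2 : ∫⁻ x in Eᶜ, w x ≤ 1 / 2 := by
    calc ∫⁻ x in Eᶜ, w x ≤ ∫⁻ x in F, w x := lintegral_mono_set h1
      _ ≤ ∫⁻ x in F, ENNReal.ofReal (Real.exp t) * ψ x :=
          setLIntegral_mono' hFm fun x hx => hx
      _ ≤ ∫⁻ x, ENNReal.ofReal (Real.exp t) * ψ x := setLIntegral_le_lintegral _ _
      _ = ENNReal.ofReal (Real.exp t) * ∫⁻ x, ψ x := lintegral_const_mul _ hψ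
      _ ≤ ENNReal.ofReal (Real.exp t) * Φ := by gcongr
      _ ≤ 1 / 2 := ht
  have h3 : 1 ≤ weightOf w E + 1 / 2 := by
    calc (1 : ℝ≥0∞) = ∫⁻ x in E ∪ Eᶜ, w x := by
          rw [Set.union_compl_self, setLIntegral_univ, h.lintegral_weight]
      _ ≤ (∫⁻ x in E, w x) + ∫⁻ x in Eᶜ, w x := lintegral_union_le _ _ _
      _ ≤ _ := by
          unfold weightOf
          gcongr
  have h4 : (1 : ℝ≥0∞) / 2 ≠ ∞ := by simp
  exact (ENNReal.add_le_add_iff_right h4).1 ((ENNReal.add_halves 1).le.trans h3)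

/-- The counterexample for a symbol that is positive somewhere. The level set enters through any
set `E` containing all points at which the principal value exceeds `t`. -/
lemma exists_counterexample_of_pos (hd : d ≠ 0) (hΩ : IsCZSymbol Ω) {x₀ : EuclideanSpace ℝ (Fin d)}
    (hx₀ : x₀ ≠ 0) (hpos : 0 < Ω x₀) {N : ℝ} (hN : 0 < N) :
    ∃ w : EuclideanSpace ℝ (Fin d) → ℝ≥0∞, Measurable w ∧ ∃ f : EuclideanSpace ℝ (Fin d) → ℝ,
      MemWeightedL1 f (maximalFunction w) ∧ 0 < weightedNorm f (maximalFunction w) ∧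
      (∀ᵐ x, ∃ l, HasPrincipalValue Ω f x l) ∧ ∃ t : ℝ, 0 < t ∧
        ∀ E : Set (EuclideanSpace ℝ (Fin d)),
          (∀ x u, HasPrincipalValue Ω f x u → t < |u| → x ∈ E) →
          ENNReal.ofReal (N / t) * weightedNorm f (maximalFunction w) ≤ weightOf w E := by
  have hn : 0 < ‖x₀‖ := norm_pos_iff.2 hx₀
  set e := ‖x₀‖⁻¹ • x₀ with he_def
  have he : ‖e‖ = 1 := by simp [e, norm_smul, hn.ne']
  have hΩe : 0 < Ω e := by rwa [he_def, hΩ.homogeneous _ (inv_pos.2 hn) _ hx₀]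
  have he0 : e ≠ 0 := by rintro h; simp [h] at he
  have hcont : ContinuousAt Ω e :=
    hΩ.contDiffOn.continuousOn.continuousAt (isOpen_compl_singleton.mem_nhds he0)
  obtain ⟨r, hr, hball⟩ := Metric.eventually_nhds_iff.1
    (hcont.eventually_const_lt (half_lt_self hΩe))
  obtain ⟨B, hB0, hB⟩ := hΩ.exists_bound
  have hV := unitVolume_pos d
  -- `3 * δ < r` keeps `e + v` in the ball where `Ω` exceeds half of `Ω e`.
  set δ := min (1 / 16) (r / 4) with hδ_def
  have hδ : 0 < δ := by positivity
  have hδ' : δ ≤ 1 / 16 := min_le_left _ _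
  have hδr : δ ≤ r / 4 := min_le_right _ _
  -- The second term caps each `coreGain` at one, as the linearisation of the exponential requires.
  set c := min (Ω e / 2) (2 ^ d / unitVolume d) with hc_def
  have hc : 0 < c := by positivity
  have hc' : c * unitVolume d ≤ 2 ^ d := by
    rw [← le_div_iff₀ hV]
    exact min_le_right _ _
  have hlow : ∀ v, ‖v‖ ≤ 3 * δ → c ≤ Ω (e + v) := fun v hv => by
    have : dist (e + v) e < r := by
      rw [dist_eq_norm, add_sub_cancel_left]
      linarith
    exact (min_le_left _ _).trans (hball this).le
  obtain ⟨m, n, t, hm, hn0, ht, hNt, hexp⟩ := exists_parameters hd hδ hδ' hc hc' hB0 hN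
  obtain ⟨f, w, hfw, hcore⟩ := exists_isConfiguration hd hm hΩ he hδ hδ' hc hlow hB0 hB n
  have hH : (n : ℝ≥0∞) * ENNReal.ofReal (maximalIncrement d m δ) < ∞ :=
    ENNReal.mul_lt_top (ENNReal.natCast_lt_top n) ENNReal.ofReal_lt_top
  have half : ENNReal.ofReal (1 / 2) = 1 / 2 := by
    rw [ENNReal.ofReal_div_of_pos two_pos]
    simp
  refine ⟨w, hfw.measurable_weight, f, hfw.memWeightedL1 hH,
    hfw.weightedNorm_pos hδ hδ' (hcore hn0), hfw.ae_hasPrincipalValue, t, ht, fun E hE => ?_⟩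
  calc ENNReal.ofReal (N / t) * weightedNorm f (maximalFunction w)
      ≤ ENNReal.ofReal (N / t) * (n * ENNReal.ofReal (maximalIncrement d m δ)) := by
        gcongr
        exact hfw.weightedNorm_le
    _ = ENNReal.ofReal (N / t * (n * maximalIncrement d m δ)) := by
        rw [ENNReal.ofReal_mul (by positivity), ENNReal.ofReal_mul (Nat.cast_nonneg n),
          ENNReal.ofReal_natCast]
    _ ≤ 1 / 2 := by
        rw [← half]
        exact ENNReal.ofReal_le_ofReal hNt
    _ ≤ weightOf w E := by
        refine hfw.half_le_weightOf ?_ hE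
        rw [← ENNReal.ofReal_pow (momentFactor_nonneg hm hδ),
          ← ENNReal.ofReal_mul (Real.exp_pos _).le, ← half]
        exact ENNReal.ofReal_le_ofReal hexp

/-- If `Ω` is negative at the given point, the pair built for `-Ω` serves: the principal values
change sign and their absolute values do not. -/
lemma exists_counterexample (hd : d ≠ 0) (hΩ : IsCZSymbol Ω) (hne : ∃ x, x ≠ 0 ∧ Ω x ≠ 0) {N : ℝ}
    (hN : 0 < N) :
    ∃ w : EuclideanSpace ℝ (Fin d) → ℝ≥0∞, Measurable w ∧ ∃ f : EuclideanSpace ℝ (Fin d) → ℝ,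
      MemWeightedL1 f (maximalFunction w) ∧ 0 < weightedNorm f (maximalFunction w) ∧
      (∀ᵐ x, ∃ l, HasPrincipalValue Ω f x l) ∧ ∃ t : ℝ, 0 < t ∧
        ENNReal.ofReal (N / t) * weightedNorm f (maximalFunction w) ≤
          weightOf w {x | t < |czOperator Ω f x|} := by
  obtain ⟨x₀, hx₀, hΩ₀⟩ := hne
  rcases lt_or_gt_of_ne hΩ₀ with hlt | hgt
  · obtain ⟨w, hw, f, hf, hpos, hpv, t, ht, hE⟩ :=
      exists_counterexample_of_pos hd hΩ.neg hx₀ (neg_pos.2 hlt) hN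
    have hneg : ∀ x l, HasPrincipalValue (fun z => -Ω z) f x l → HasPrincipalValue Ω f x (-l) :=
      fun x l h => by simpa only [neg_neg] using h.neg_symbol
    refine ⟨w, hw, f, hf, hpos, ?_, t, ht, hE _ fun x u hu htu => ?_⟩
    · filter_upwards [hpv] with x ⟨l, hl⟩
      exact ⟨-l, hneg x l hl⟩
    · rw [Set.mem_ofPred_eq, (hneg x u hu).czOperator_eq, abs_neg]
      exact htu
  · obtain ⟨w, hw, f, hf, hpos, hpv, t, ht, hE⟩ :=
      exists_counterexample_of_pos hd hΩ hx₀ hgt hN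
    refine ⟨w, hw, f, hf, hpos, hpv, t, ht, hE _ fun x u hu htu => ?_⟩
    rw [Set.mem_ofPred_eq, hu.czOperator_eq]
    exact htu

lemma not_weakTypeConjecture (hd : d ≠ 0) (hΩ : IsCZSymbol Ω) (hne : ∃ x, x ≠ 0 ∧ Ω x ≠ 0) :
    ¬ WeakTypeConjecture Ω := by
  rintro ⟨C, hC, h⟩
  -- With `N = 2 * C` the weighted norm, being positive and finite, cancels and leaves `2 * C ≤ C`.
  obtain ⟨w, hw, f, hf, hpos, hpv, t, ht, hle⟩ :=
    exists_counterexample hd hΩ hne (mul_pos two_pos hC)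
  have h1 := hle.trans (h w hw t ht f hf hpv)
  have h2 : ENNReal.ofReal (2 * C / t) ≤ ENNReal.ofReal (C / t) :=
    (ENNReal.mul_le_mul_iff_left hpos.ne' hf.2.2.ne).1 h1
  rw [ENNReal.ofReal_le_ofReal_iff (by positivity), mul_div_assoc] at h2
  have : 0 < C / t := by positivity
  linarith

end Counterexample

end

end MuckenhouptWheeden

theorem theorem1 (d : ℕ) (hd : 1 ≤ d) (Ω : EuclideanSpace ℝ (Fin d) → ℝ)
    (hΩ : MuckenhouptWheeden.IsCZSymbol Ω) (hne : ∃ x, x ≠ 0 ∧ Ω x ≠ 0) :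
    (∀ N : ℝ, 0 < N →
      ∃ w : EuclideanSpace ℝ (Fin d) → ℝ≥0∞, Measurable w ∧
      ∃ f : EuclideanSpace ℝ (Fin d) → ℝ,
        MuckenhouptWheeden.MemWeightedL1 f (MuckenhouptWheeden.maximalFunction w) ∧
        0 < MuckenhouptWheeden.weightedNorm f (MuckenhouptWheeden.maximalFunction w) ∧
        (∀ᵐ x, ∃ l, MuckenhouptWheeden.HasPrincipalValue Ω f x l) ∧
        ∃ t : ℝ, 0 < t ∧
          ENNReal.ofReal (N / t) *
              MuckenhouptWheeden.weightedNorm f (MuckenhouptWheeden.maximalFunction w) ≤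
            MuckenhouptWheeden.weightOf w
              {x | t < |MuckenhouptWheeden.czOperator Ω f x|}) ∧
    ¬ MuckenhouptWheeden.WeakTypeConjecture Ω :=
  have hd' : d ≠ 0 := Nat.one_le_iff_ne_zero.1 hd
  ⟨fun _ hN => MuckenhouptWheeden.exists_counterexample hd' hΩ hne hN,
    MuckenhouptWheeden.not_weakTypeConjecture hd' hΩ hne⟩
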